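/- Let $n\ge 2$ and let $\langle\,,\,\rangle_0$ be any bi-invariant Riemannian metric on $\operatorname{SO}(2n)$. Let $\operatorname{SO}(2n-2)\subset\operatorname{SO}(2n-1)\subset\operatorname{SO}(2n)$ be the standard block inclusions $A\mapsto\operatorname{diag}(A,1)$, let $\operatorname{U}(n)\subset\operatorname{SO}(2n)$ be the subgroup of complex linear maps of $\mathbf{R}^{2n}=\mathbf{C}^n$, and similarly $\operatorname{U}(n-1)\subset\operatorname{SO}(2n-2)$. Let $Q(X,Y)=-\frac12\operatorname{tr}(XY)$, let $\mathfrak p_1$ be the $Q$-orthogonal complement of $\mathfrak u(n-1)$ in $\mathfrak{so}(2n-2)$ and $\mathfrak p_2$ the $Q$-orthogonal complement of $\mathfrak{so}(2n-2)$ in $\mathfrak{so}(2n-1)$, so that $\mathfrak{so}(2n-1)=\mathfrak u(n-1)\oplus\mathfrak p_1\oplus\mathfrak p_2$. Then: 1. The inclusion $\operatorname{SO}(2n-1)\subset\operatorname{SO}(2n)$ induces a homeomorphism $\Phi:\operatorname{SO}(2n-1)/\operatorname{U}(n-1)\to\operatorname{SO}(2n)/\operatorname{U}(n)$, and $B\mapsto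 Be_{2n-1}$ (the image of the last standard basis vector) induces a homeomorphism $\Psi:\operatorname{SO}(2n-1)/\operatorname{SO}(2n-2)\to\mathbf{S}^{2n-2}$ onto the unit sphere of $\mathbf{R}^{2n-1}$. 2. There are $\lambda_1>0$ and $\lambda_2=\frac12\lambda_1$ such that the homogeneous metric $\lambda_1Q|_{\mathfrak p_1}\perp\lambda_2Q|_{\mathfrak p_2}$ on $\operatorname{SO}(2n-1)/\operatorname{U}(n-1)$ corresponds under $\Phi$ to the normal homogeneous metric on $\operatorname{SO}(2n)/\operatorname{U}(n)$ induced by $\langle\,,\,\rangle_0$. That is, for all $B\in\operatorname{SO}(2n-1)$, $X,X'\in\mathfrak p_1$, $Y,Y'\in\mathfrak p_2$, the components of the tangent vectors $B(X+Y)$ and $B(X'+Y')$ of $\operatorname{SO}(2n)$ at $B$ that are $\langle\,,\,\rangle_0$-orthogonal to the coset $B\operatorname{U}(n)$ have inner product $\lambda_1Q(X,X')+\lambda_2Q(Y,Y')$. 3. For these constants, the composition $\pi$ of the projection $\operatorname{SO}(2n)\to\operatorname{SO}(2n)/\operatorname{U}(n)$, the identification $\Phi^{-1}$, the projection $\operatorname{SO}(2n-1)/\operatorname{U}(n-1)\to\operatorname{SO}(2n-1)/\operatorname{SO}(2n-2)$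 and the identification $\Psi$ is a Riemannian submersion $$\pi:(\operatorname{SO}(2n),\langle\,,\,\rangle_0)\longrightarrow(\mathbf{S}^{2n-2},\ \lambda_2\, g_{\rm round})$$ onto the sphere, with connected fibres, where $g_{\rm round}$ is the metric of the unit sphere. -/

import Mathlib

open Matrix
open scoped Manifold ContDiff

/-! ### The special orthogonal group as a smooth manifold -/

/-- The special orthogonal group `SO(m)` of real `m × m` matrices. -/
abbrev SO (m : ℕ) : Type := Matrix.specialOrthogonalGroup (Fin m) ℝ

/-- The Lie algebra `so(m)` of skew-symmetric real `m × m` matrices. -/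
def so (m : ℕ) : Submodule ℝ (Matrix (Fin m) (Fin m) ℝ) where
  carrier := {X | Xᵀ = -X}
  zero_mem' := by simp
  add_mem' := by
    intro a b (ha : _ = _) (hb : _ = _)
    simp [ha, hb, add_comm]
  smul_mem' := by
    intro c a (ha : _ = _)
    simp [ha]

/-- The model space of the manifold `SO(m)`: coordinates on `so(m)` given by the entries above
the diagonal. -/
abbrev SkewCoord (m : ℕ) : Type := {p : Fin m × Fin m // p.1 < p.2} → ℝ

namespace SO

variable {m : ℕ}

/-- The skew-symmetric matrix with given entries above the diagonal. -/
def skew (x : SkewCoord m) : Matrix (Fin m) (Fin m) ℝ :=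
  Matrix.of fun i j =>
    if h : i < j then x ⟨(i, j), h⟩ else if h : j < i then -x ⟨(j, i), h⟩ else 0

/-- The entries of a matrix above the diagonal. -/
def upper (X : Matrix (Fin m) (Fin m) ℝ) : SkewCoord m := fun p => X p.1.1 p.1.2

/-- The Cayley transform `X ↦ (1 + X)(1 - X)⁻¹` from skew-symmetric to rotation matrices. -/
noncomputable def cayley (X : Matrix (Fin m) (Fin m) ℝ) : Matrix (Fin m) (Fin m) ℝ :=
  (1 + X) * (1 - X)⁻¹

/-- The inverse `M ↦ (M - 1)(M + 1)⁻¹` of the Cayley transform. -/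
noncomputable def cayleyInv (M : Matrix (Fin m) (Fin m) ℝ) : Matrix (Fin m) (Fin m) ℝ :=
  (M - 1) * (M + 1)⁻¹

theorem skew_transpose (x : SkewCoord m) : (skew x)ᵀ = -skew x := by
  ext i j
  simp only [skew, transpose_apply, of_apply, Matrix.neg_apply]
  split_ifs <;> first | omega | simp

theorem upper_skew (x : SkewCoord m) : upper (skew x) = x := by
  ext p
  simp [upper, skew, p.2]

theorem skew_upper {X : Matrix (Fin m) (Fin m) ℝ} (h : Xᵀ = -X) : skew (upper X) = X := by
  ext i j
  have hij := congrFun (congrFun h i) j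
  simp only [transpose_apply, Matrix.neg_apply] at hij
  simp only [skew, upper, of_apply]
  split_ifs with h1 h2
  · rfl
  · linarith
  · obtain rfl : i = j := by omega
    linarith

theorem mem_iff {A : Matrix (Fin m) (Fin m) ℝ} :
    A ∈ Matrix.specialOrthogonalGroup (Fin m) ℝ ↔ A * Aᵀ = 1 ∧ A.det = 1 := by
  rw [mem_specialOrthogonalGroup_iff, mem_orthogonalGroup_iff]

theorem mul_transpose (A : SO m) : (A : Matrix (Fin m) (Fin m) ℝ) * (A.1)ᵀ = 1 := (mem_iff.1 A.2).1

theorem transpose_mul (A : SO m) : (A.1)ᵀ * (A : Matrix (Fin m) (Fin m) ℝ) = 1 :=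
  mul_eq_one_comm.1 (mul_transpose A)

theorem inv_coe (A : SO m) : ((A⁻¹ : SO m) : Matrix (Fin m) (Fin m) ℝ) = (A.1)ᵀ := by
  have h : ((A⁻¹ : SO m) : Matrix (Fin m) (Fin m) ℝ) * A.1 = 1 := by
    rw [← Submonoid.coe_mul, inv_mul_cancel]; rfl
  calc _ = ((A⁻¹ : SO m) : Matrix (Fin m) (Fin m) ℝ) * (A.1 * (A.1)ᵀ) := by
        rw [mul_transpose, mul_one]
    _ = _ := by rw [← mul_assoc, h, one_mul]

theorem isUnit_one_sub {X : Matrix (Fin m) (Fin m) ℝ} (h : Xᵀ = -X) : IsUnit (1 - X).det := by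
  rw [isUnit_iff_ne_zero]
  intro h0
  obtain ⟨v, hv, hv0⟩ := Matrix.exists_mulVec_eq_zero_iff.2 h0
  rw [sub_mulVec, one_mulVec, sub_eq_zero] at hv0
  have h1 : v ⬝ᵥ (X *ᵥ v) = -(v ⬝ᵥ (X *ᵥ v)) := by
    conv_lhs => rw [dotProduct_mulVec, ← mulVec_transpose, h, neg_mulVec, neg_dotProduct,
      dotProduct_comm]
  rw [← hv0] at h1
  exact hv (dotProduct_self_eq_zero.1 (by linarith))

theorem cayley_mem {X : Matrix (Fin m) (Fin m) ℝ} (h : Xᵀ = -X) :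
    cayley X ∈ Matrix.specialOrthogonalGroup (Fin m) ℝ := by
  have hu := isUnit_one_sub h
  have ht : (1 - X)ᵀ = 1 + X := by simp [h]
  have hu' : IsUnit (1 + X).det := by rwa [← ht, det_transpose]
  rw [mem_iff]
  constructor
  · have ht' : (1 + X)ᵀ = 1 - X := by rw [← ht, transpose_transpose]
    have hc : (1 - X)⁻¹ * (1 + X)⁻¹ = (1 + X)⁻¹ * (1 - X)⁻¹ := by
      rw [← Matrix.mul_inv_rev, ← Matrix.mul_inv_rev]
      congr 1
      noncomm_ring
    rw [cayley, Matrix.transpose_mul, transpose_nonsing_inv, ht, ht', mul_assoc,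
      ← mul_assoc _ _ (1 - X), hc, mul_assoc, nonsing_inv_mul _ hu, mul_one,
      mul_nonsing_inv _ hu']
  · rw [cayley, det_mul, det_nonsing_inv, ← ht, det_transpose]
    exact Ring.mul_inverse_cancel _ hu

theorem cayley_add_one {X : Matrix (Fin m) (Fin m) ℝ} (h : Xᵀ = -X) :
    cayley X + 1 = (2 : ℝ) • (1 - X)⁻¹ := by
  have hu := isUnit_one_sub h
  have : cayley X + 1 = (1 + X) * (1 - X)⁻¹ + (1 - X) * (1 - X)⁻¹ := by
    rw [mul_nonsing_inv _ hu, cayley]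
  rw [this, ← add_mul, two_smul]
  noncomm_ring

theorem det_cayley_add_one {X : Matrix (Fin m) (Fin m) ℝ} (h : Xᵀ = -X) :
    (cayley X + 1).det ≠ 0 := by
  rw [cayley_add_one h, det_smul]
  exact mul_ne_zero (by positivity)
    ((isUnit_nonsing_inv_det _ (isUnit_one_sub h)).ne_zero)

theorem cayleyInv_cayley {X : Matrix (Fin m) (Fin m) ℝ} (h : Xᵀ = -X) :
    cayleyInv (cayley X) = X := by
  have hu := isUnit_one_sub h
  have h1 : cayley X - 1 = X * (cayley X + 1) := by
    have : cayley X - 1 = (1 + X) * (1 - X)⁻¹ - (1 - X) * (1 - X)⁻¹ := by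
      rw [mul_nonsing_inv _ hu, cayley]
    rw [this, cayley_add_one h, ← sub_mul, mul_smul_comm, two_smul]
    noncomm_ring
  rw [cayleyInv, h1, mul_assoc, mul_nonsing_inv _ (isUnit_iff_ne_zero.2 (det_cayley_add_one h)),
    mul_one]

theorem cayleyInv_transpose {M : Matrix (Fin m) (Fin m) ℝ} (hM : M * Mᵀ = 1)
    (h : (M + 1).det ≠ 0) : (cayleyInv M)ᵀ = -cayleyInv M := by
  have hu : IsUnit (M + 1).det := isUnit_iff_ne_zero.2 h
  have hu' : IsUnit (Mᵀ + 1).det := by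
    rwa [← transpose_one, ← transpose_add, det_transpose]
  have hM' : Mᵀ * M = 1 := mul_eq_one_comm.1 hM
  have key : (Mᵀ - 1) * (M + 1) = -((Mᵀ + 1) * (M - 1)) := by
    simp only [sub_mul, add_mul, mul_add, mul_sub, hM', one_mul, mul_one]
    abel
  rw [cayleyInv, Matrix.transpose_mul, transpose_nonsing_inv, transpose_add, transpose_sub, transpose_one]
  calc (Mᵀ + 1)⁻¹ * (Mᵀ - 1) = (Mᵀ + 1)⁻¹ * ((Mᵀ - 1) * (M + 1)) * (M + 1)⁻¹ := by
        rw [mul_assoc, mul_assoc, mul_nonsing_inv _ hu, mul_one]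
    _ = -((M - 1) * (M + 1)⁻¹) := by
        rw [key, mul_neg, ← mul_assoc, nonsing_inv_mul _ hu', one_mul, neg_mul]

theorem cayley_cayleyInv {M : Matrix (Fin m) (Fin m) ℝ} (h : (M + 1).det ≠ 0) :
    cayley (cayleyInv M) = M := by
  have hu : IsUnit (M + 1).det := isUnit_iff_ne_zero.2 h
  have h1 : 1 + cayleyInv M = M * ((2 : ℝ) • (M + 1)⁻¹) := by
    have : 1 + cayleyInv M = (M + 1) * (M + 1)⁻¹ + (M - 1) * (M + 1)⁻¹ := by
      rw [mul_nonsing_inv _ hu, cayleyInv]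
    rw [this, ← add_mul, mul_smul_comm, two_smul]
    noncomm_ring
  have h2 : 1 - cayleyInv M = (2 : ℝ) • (M + 1)⁻¹ := by
    have : 1 - cayleyInv M = (M + 1) * (M + 1)⁻¹ - (M - 1) * (M + 1)⁻¹ := by
      rw [mul_nonsing_inv _ hu, cayleyInv]
    rw [this, ← sub_mul, two_smul]
    noncomm_ring
  have h3 : IsUnit ((2 : ℝ) • (M + 1)⁻¹).det := by
    rw [det_smul, isUnit_iff_ne_zero]
    exact mul_ne_zero (by positivity) ((isUnit_nonsing_inv_det _ hu).ne_zero)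
  rw [cayley, h1, h2, mul_assoc, mul_nonsing_inv _ h3, mul_one]

/-- The chart of `SO(m)` centred at `A`: it is defined at those `P` for which `-1` is not an
eigenvalue of `A⁻¹ P`, and its inverse is `X ↦ A (1 + X)(1 - X)⁻¹`. -/
noncomputable def chart (A : SO m) : OpenPartialHomeomorph (SO m) (SkewCoord m) where
  toFun P := upper (cayleyInv ((A.1)ᵀ * P.1))
  invFun x := A * ⟨cayley (skew x), cayley_mem (skew_transpose x)⟩
  source := {P | ((A.1)ᵀ * P.1 + 1).det ≠ 0}
  target := Set.univ
  map_source' _ _ := Set.mem_univ _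
  map_target' x _ := by
    simp only [Set.mem_ofPred_eq, Submonoid.coe_mul, ← mul_assoc, transpose_mul, one_mul]
    exact det_cayley_add_one (skew_transpose x)
  left_inv' P hP := by
    apply Subtype.ext
    have h1 : ((A.1)ᵀ * P.1) * ((A.1)ᵀ * P.1)ᵀ = 1 := by
      rw [Matrix.transpose_mul, transpose_transpose, mul_assoc, ← mul_assoc P.1, mul_transpose, one_mul,
        transpose_mul]
    simp only [Submonoid.coe_mul]
    rw [skew_upper (cayleyInv_transpose h1 hP), cayley_cayleyInv hP, ← mul_assoc, mul_transpose,
      one_mul]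
  right_inv' x _ := by
    simp only [Submonoid.coe_mul, ← mul_assoc, transpose_mul, one_mul]
    rw [cayleyInv_cayley (skew_transpose x), upper_skew]
  continuousOn_toFun := by
    have hc : Continuous fun P : SO m => (A.1)ᵀ * P.1 :=
      continuous_const.matrix_mul continuous_subtype_val
    have hc1 : Continuous fun P : SO m => (A.1)ᵀ * P.1 + 1 := hc.add continuous_const
    have hi : ContinuousOn (fun P : SO m => ((A.1)ᵀ * P.1 + 1)⁻¹)
        {P | ((A.1)ᵀ * P.1 + 1).det ≠ 0} := by
      simp only [Matrix.inv_def, Ring.inverse_eq_inv']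
      exact (hc1.matrix_det.continuousOn.inv₀ fun P hP => hP).smul
        hc1.matrix_adjugate.continuousOn
    have hm : ContinuousOn (fun P : SO m => cayleyInv ((A.1)ᵀ * P.1))
        {P | ((A.1)ᵀ * P.1 + 1).det ≠ 0} :=
      (hc.sub continuous_const).continuousOn.mul hi
    refine continuousOn_pi.2 fun p => ?_
    exact (continuous_id.matrix_elem p.1.1 p.1.2).comp_continuousOn hm
  continuousOn_invFun := by
    refine Continuous.continuousOn ?_
    have hs : Continuous (skew : SkewCoord m → _) := by
      refine continuous_matrix fun i j => ?_
      simp only [skew, of_apply]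
      split_ifs <;> fun_prop
    have h1 : Continuous fun x : SkewCoord m => 1 - skew x := continuous_const.sub hs
    have hi : Continuous fun x : SkewCoord m => (1 - skew x)⁻¹ := by
      simp only [Matrix.inv_def, Ring.inverse_eq_inv']
      exact (h1.matrix_det.inv₀ fun x => (isUnit_one_sub (skew_transpose x)).ne_zero).smul
        h1.matrix_adjugate
    refine Continuous.subtype_mk (f := fun x : SkewCoord m => A.1 * cayley (skew x)) ?_ _
    exact continuous_const.matrix_mul ((continuous_const.add hs).matrix_mul hi)
  open_source := by
    have hc : Continuous fun P : SO m => ((A.1)ᵀ * P.1 + 1).det :=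
      ((continuous_const.matrix_mul continuous_subtype_val).add continuous_const).matrix_det
    exact isOpen_ne_fun hc continuous_const
  open_target := isOpen_univ

noncomputable instance : ChartedSpace (SkewCoord m) (SO m) where
  atlas := Set.range chart
  chartAt := chart
  mem_chart_source A := by
    change ((A.1)ᵀ * A.1 + 1).det ≠ 0
    rw [transpose_mul, one_add_one_eq_two, show (2 : Matrix (Fin m) (Fin m) ℝ) = (2 : ℝ) • 1 by
      rw [two_smul, one_add_one_eq_two], det_smul, det_one, mul_one]
    positivity
  chart_mem_atlas A := ⟨A, rfl⟩

/-- A matrix-valued map all of whose entries are smooth on `s`. -/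
def SmoothOn (f : SkewCoord m → Matrix (Fin m) (Fin m) ℝ) (s : Set (SkewCoord m)) : Prop :=
  ∀ i j, ContDiffOn ℝ ∞ (fun x => f x i j) s

theorem SmoothOn.mul {f g : SkewCoord m → Matrix (Fin m) (Fin m) ℝ} {s : Set (SkewCoord m)}
    (hf : SmoothOn f s) (hg : SmoothOn g s) : SmoothOn (fun x => f x * g x) s := by
  intro i j
  simp only [Matrix.mul_apply]
  exact ContDiffOn.sum fun k _ => (hf i k).mul (hg k j)

theorem SmoothOn.const (M : Matrix (Fin m) (Fin m) ℝ) (s : Set (SkewCoord m)) :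
    SmoothOn (fun _ => M) s := fun _ _ => contDiffOn_const

theorem SmoothOn.add {f g : SkewCoord m → Matrix (Fin m) (Fin m) ℝ} {s : Set (SkewCoord m)}
    (hf : SmoothOn f s) (hg : SmoothOn g s) : SmoothOn (fun x => f x + g x) s :=
  fun i j => (hf i j).add (hg i j)

theorem SmoothOn.sub {f g : SkewCoord m → Matrix (Fin m) (Fin m) ℝ} {s : Set (SkewCoord m)}
    (hf : SmoothOn f s) (hg : SmoothOn g s) : SmoothOn (fun x => f x - g x) s :=
  fun i j => (hf i j).sub (hg i j)

theorem SmoothOn.det {f : SkewCoord m → Matrix (Fin m) (Fin m) ℝ} {s : Set (SkewCoord m)}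
    (hf : SmoothOn f s) : ContDiffOn ℝ ∞ (fun x => (f x).det) s := by
  simp only [Matrix.det_apply]
  refine ContDiffOn.sum fun σ _ => ?_
  exact ContDiffOn.const_smul _ (contDiffOn_prod fun i _ => hf _ _)

theorem SmoothOn.inv {f : SkewCoord m → Matrix (Fin m) (Fin m) ℝ} {s : Set (SkewCoord m)}
    (hf : SmoothOn f s) (h : ∀ x ∈ s, (f x).det ≠ 0) : SmoothOn (fun x => (f x)⁻¹) s := by
  intro i j
  simp only [Matrix.inv_def, Ring.inverse_eq_inv', Matrix.smul_apply, adjugate_apply, smul_eq_mul]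
  refine (hf.det.inv h).mul (SmoothOn.det ?_)
  intro k l
  by_cases hk : k = j
  · subst hk
    simp only [updateRow_self]
    exact contDiffOn_const
  · simp only [updateRow_ne hk]
    exact hf k l

theorem smoothOn_skew (s : Set (SkewCoord m)) : SmoothOn skew s := by
  intro i j
  simp only [skew, of_apply]
  split_ifs <;> fun_prop

instance : IsManifold 𝓘(ℝ, SkewCoord m) ∞ (SO m) := by
  refine isManifold_of_contDiffOn _ _ _ ?_
  rintro _ _ ⟨A, rfl⟩ ⟨B, rfl⟩
  have hs : (𝓘(ℝ, SkewCoord m).symm ⁻¹' ((chart A).symm ≫ₕ chart B).source ∩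
      Set.range 𝓘(ℝ, SkewCoord m)) ⊆
      {x | ((B.1)ᵀ * (A.1 * cayley (skew x)) + 1).det ≠ 0} := fun x hx => hx.1.2
  refine ContDiffOn.mono ?_ hs
  refine contDiffOn_pi.2 fun p => ?_
  have hc : ∀ s, SmoothOn (fun x : SkewCoord m => cayley (skew x)) s := fun s =>
    ((SmoothOn.const 1 s).add (smoothOn_skew s)).mul
      (((SmoothOn.const 1 s).sub (smoothOn_skew s)).inv
        fun x _ => (isUnit_one_sub (skew_transpose x)).ne_zero)
  have hM := fun s => (SmoothOn.const (B.1)ᵀ s).mul ((SmoothOn.const A.1 s).mul (hc s))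
  exact (((hM _).sub (SmoothOn.const 1 _)).mul
    (((hM _).add (SmoothOn.const 1 _)).inv fun x hx => hx)) p.1.1 p.1.2

end SO

/-! ### Riemannian metrics and Riemannian submersions -/

/-- Smooth Riemannian metrics on `SO(m)`. -/
abbrev SO.RiemannianMetric (m : ℕ) : Type :=
  Bundle.ContMDiffRiemannianMetric 𝓘(ℝ, SkewCoord m) ∞ (SkewCoord m)
    (fun A : SO m => TangentSpace 𝓘(ℝ, SkewCoord m) A)

/-- A Riemannian metric on `SO(m)` is bi-invariant if all left and all right translations are
isometries. -/
def SO.IsBiInvariant {m : ℕ} (g : SO.RiemannianMetric m) : Prop :=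
  (∀ (A P : SO m) (v w : TangentSpace 𝓘(ℝ, SkewCoord m) P),
    g.inner (A * P)
      (mfderiv 𝓘(ℝ, SkewCoord m) 𝓘(ℝ, SkewCoord m) (fun R : SO m => A * R) P v)
      (mfderiv 𝓘(ℝ, SkewCoord m) 𝓘(ℝ, SkewCoord m) (fun R : SO m => A * R) P w) =
    g.inner P v w) ∧
  (∀ (A P : SO m) (v w : TangentSpace 𝓘(ℝ, SkewCoord m) P),
    g.inner (P * A)
      (mfderiv 𝓘(ℝ, SkewCoord m) 𝓘(ℝ, SkewCoord m) (fun R : SO m => R * A) P v)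
      (mfderiv 𝓘(ℝ, SkewCoord m) 𝓘(ℝ, SkewCoord m) (fun R : SO m => R * A) P w) =
    g.inner P v w)

/-- A Riemannian submersion with connected fibres from `M`, with metric `gM`, onto `N`, with
metric `gN`: a smooth surjective submersion whose differential at every point is isometric on the
orthogonal complement of its kernel, and all of whose fibres are connected. -/
def IsRiemannianSubmersion
    {E : Type*} [NormedAddCommGroup E] [NormedSpace ℝ E] {H : Type*} [TopologicalSpace H]
    (I : ModelWithCorners ℝ E H) {M : Type*} [TopologicalSpace M] [ChartedSpace H M]
    {E' : Type*} [NormedAddCommGroup E'] [NormedSpace ℝ E'] {H' : Type*} [TopologicalSpace H']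
    (I' : ModelWithCorners ℝ E' H') {N : Type*} [TopologicalSpace N] [ChartedSpace H' N]
    (gM : ∀ x : M, TangentSpace I x → TangentSpace I x → ℝ)
    (gN : ∀ y : N, TangentSpace I' y → TangentSpace I' y → ℝ) (f : M → N) : Prop :=
  ContMDiff I I' ∞ f ∧
  Function.Surjective f ∧
  (∀ x, Function.Surjective (mfderiv I I' f x)) ∧
  (∀ (x : M) (v w : TangentSpace I x),
    (∀ u : TangentSpace I x, mfderiv I I' f x u = 0 → gM x v u = 0) →
    (∀ u : TangentSpace I x, mfderiv I I' f x u = 0 → gM x w u = 0) →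
    gN (f x) (mfderiv I I' f x v) (mfderiv I I' f x w) = gM x v w) ∧
  (∀ y : N, IsConnected (f ⁻¹' {y}))

/-- The unit sphere `S^{2n-2}` in `ℝ^{2n-1}`. -/
abbrev EvenSphere (n : ℕ) : Type := Metric.sphere (0 : EuclideanSpace ℝ (Fin (2 * n - 1))) 1

instance finrank_euclidean_odd (n : ℕ) [n.AtLeastTwo] :
    Fact (Module.finrank ℝ (EuclideanSpace ℝ (Fin (2 * n - 1))) = 2 * n - 2 + 1) :=
  ⟨by
    have := Nat.AtLeastTwo.prop (n := n)
    rw [finrank_euclideanSpace_fin]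
    omega⟩

/-- A tangent vector of the unit sphere `S^{2n-2}` as a vector of the ambient `ℝ^{2n-1}`. -/
noncomputable def EvenSphere.toVec {n : ℕ} [n.AtLeastTwo] (x : EvenSphere n)
    (v : TangentSpace (𝓡 (2 * n - 2)) x) : EuclideanSpace ℝ (Fin (2 * n - 1)) :=
  mfderiv (𝓡 (2 * n - 2)) 𝓘(ℝ, EuclideanSpace ℝ (Fin (2 * n - 1)))
    (Subtype.val : EvenSphere n → EuclideanSpace ℝ (Fin (2 * n - 1))) x v

/-- The round metric on the unit sphere `S^{2n-2}`, multiplied by the constant `c`: for `c > 0`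
this is isometric to the round sphere of radius `√c`. -/
noncomputable def roundMetric (n : ℕ) [n.AtLeastTwo] (c : ℝ) (x : EvenSphere n)
    (v w : TangentSpace (𝓡 (2 * n - 2)) x) : ℝ :=
  c * inner ℝ (EvenSphere.toVec x v) (EvenSphere.toVec x w)

/-! ### The subgroups and the homogeneous spaces -/

/-- The splitting of `{0, …, M-1}` into its first `m` elements and the remaining ones. -/
def blockEquiv {m M : ℕ} (h : m ≤ M) : Fin m ⊕ Fin (M - m) ≃ Fin M :=
  finSumFinEquiv.trans (finCongr (Nat.add_sub_cancel' h))

/-- The standard inclusion `SO(m) ⊆ SO(M)`, `A ↦ diag(A, 1)`, for `m ≤ M`. -/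
def SO.incl {m M : ℕ} (h : m ≤ M) : SO m →* SO M where
  toFun A := ⟨reindex (blockEquiv h) (blockEquiv h) (fromBlocks A.1 0 0 1), by
    rw [SO.mem_iff]
    constructor
    · rw [transpose_reindex, reindex_apply, reindex_apply, submatrix_mul_equiv,
        fromBlocks_transpose, fromBlocks_multiply]
      simp [SO.mul_transpose]
    · simp [(SO.mem_iff.1 A.2).2]⟩
  map_one' := by
    apply Subtype.ext
    simp
  map_mul' A B := by
    apply Subtype.ext
    simp only [Submonoid.coe_mul, reindex_apply, submatrix_mul_equiv, fromBlocks_multiply]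
    simp

/-- The inclusion `so(m) ⊆ so(M)`, `X ↦ diag(X, 0)`, for `m ≤ M`. -/
def padZero {m M : ℕ} (h : m ≤ M) (X : Matrix (Fin m) (Fin m) ℝ) : Matrix (Fin M) (Fin M) ℝ :=
  reindex (blockEquiv h) (blockEquiv h) (fromBlocks X 0 0 0)

/-- Multiplication by `i` on `ℂ^k = ℝ^{2k}`: with basis vectors numbered from `0`, it maps
`e_{2j}` to `e_{2j+1}` and `e_{2j+1}` to `-e_{2j}`. -/
def complexStructure (k : ℕ) : Matrix (Fin (2 * k)) (Fin (2 * k)) ℝ :=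
  Matrix.of fun a b =>
    if (b : ℕ) % 2 = 0 ∧ (a : ℕ) = b + 1 then 1
    else if (a : ℕ) % 2 = 0 ∧ (b : ℕ) = a + 1 then -1
    else 0

/-- The unitary group `U(k)`, as the subgroup of the complex linear maps in `SO(2k)`. -/
def unitaryInSO (k : ℕ) : Subgroup (SO (2 * k)) where
  carrier := {A | A.1 * complexStructure k = complexStructure k * A.1}
  one_mem' := by simp
  mul_mem' := by
    intro A B (hA : _ = _) (hB : _ = _)
    change (A * B).1 * _ = _ * (A * B).1
    rw [Submonoid.coe_mul, mul_assoc, hB, ← mul_assoc, hA, mul_assoc]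
  inv_mem' := by
    intro A (hA : _ = _)
    change (A⁻¹).1 * _ = _ * (A⁻¹).1
    rw [SO.inv_coe]
    calc (A.1)ᵀ * complexStructure k
        = (A.1)ᵀ * (complexStructure k * A.1) * (A.1)ᵀ := by
          rw [mul_assoc, mul_assoc, SO.mul_transpose, mul_one]
      _ = complexStructure k * (A.1)ᵀ := by
          rw [← hA, ← mul_assoc, SO.transpose_mul, one_mul]

/-- The Lie algebra `u(k) ⊆ so(2k)` of `U(k)`. -/
def unitaryAlgebra (k : ℕ) : Set (Matrix (Fin (2 * k)) (Fin (2 * k)) ℝ) :=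
  {X | X ∈ so (2 * k) ∧ X * complexStructure k = complexStructure k * X}

theorem two_mul_pred_le (n : ℕ) : 2 * (n - 1) ≤ 2 * n - 1 := by omega

theorem two_mul_sub_one_le (n : ℕ) : 2 * n - 1 ≤ 2 * n := by omega

/-- The subgroup `SO(2n-2) ⊆ SO(2n-1)`. -/
def evenInSO (n : ℕ) : Subgroup (SO (2 * n - 1)) := (SO.incl (two_mul_pred_le n)).range

/-- The subgroup `U(n-1) ⊆ SO(2n-2) ⊆ SO(2n-1)`. -/
def smallUnitaryInSO (n : ℕ) : Subgroup (SO (2 * n - 1)) :=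
  (unitaryInSO (n - 1)).map (SO.incl (two_mul_pred_le n))

/-- The last standard basis index of `ℝ^{2n-1}`. -/
def lastIndex (n : ℕ) [n.AtLeastTwo] : Fin (2 * n - 1) :=
  ⟨2 * n - 2, by have := Nat.AtLeastTwo.prop (n := n); omega⟩

/-! ### Homogeneous metrics -/

/-- The inner product `Q(X, Y) = -½ tr(XY)` on skew-symmetric matrices. -/
noncomputable def Q {m : ℕ} (X Y : Matrix (Fin m) (Fin m) ℝ) : ℝ := -(1 / 2) * (X * Y).trace

/-- The subspace `𝔭₁ ⊆ so(2n-1)`: the `Q`-orthogonal complement of `u(n-1)` in `so(2n-2)`. -/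
def p₁ (n : ℕ) : Set (Matrix (Fin (2 * n - 1)) (Fin (2 * n - 1)) ℝ) :=
  {Y | ∃ X ∈ so (2 * (n - 1)), (∀ W ∈ unitaryAlgebra (n - 1), Q X W = 0) ∧
    Y = padZero (two_mul_pred_le n) X}

/-- The subspace `𝔭₂ ⊆ so(2n-1)`: the `Q`-orthogonal complement of `so(2n-2)` in `so(2n-1)`. -/
def p₂ (n : ℕ) : Set (Matrix (Fin (2 * n - 1)) (Fin (2 * n - 1)) ℝ) :=
  {Y | Y ∈ so (2 * n - 1) ∧ ∀ W ∈ so (2 * (n - 1)), Q Y (padZero (two_mul_pred_le n) W) = 0}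

/-- A tangent vector of `SO(m)` at `A` as a matrix, by the differential of the inclusion of
`SO(m)` into the space of all `m × m` matrices. -/
noncomputable def SO.toMatrix {m : ℕ} (A : SO m) (v : TangentSpace 𝓘(ℝ, SkewCoord m) A) :
    Matrix (Fin m) (Fin m) ℝ :=
  Matrix.of (mfderiv 𝓘(ℝ, SkewCoord m) 𝓘(ℝ, Fin m → Fin m → ℝ)
    (fun (P : SO m) (i j : Fin m) => P.1 i j) A v : Fin m → Fin m → ℝ)

/-- `v` is tangent at `A` to the coset `A U(n)`, i.e. `v ∈ A u(n)`. -/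
def IsVertical {n : ℕ} (A : SO (2 * n)) (v : TangentSpace 𝓘(ℝ, SkewCoord (2 * n)) A) : Prop :=
  ∃ W ∈ unitaryAlgebra n, A.toMatrix v = A.1 * W

/-- `h` is the component of `v` that is orthogonal, with respect to `g`, to the coset `A U(n)`.
The tangent space of `SO(2n)/U(n)` at the coset of `A` is the tangent space of `SO(2n)` at `A`
modulo vertical vectors, and the normal homogeneous metric of the class of `v` is computed from
the horizontal component `h`. -/
def IsHorizontalPart {n : ℕ} (g : SO.RiemannianMetric (2 * n)) (A : SO (2 * n))
    (v h : TangentSpace 𝓘(ℝ, SkewCoord (2 * n)) A) : Prop :=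
  IsVertical A (v - h) ∧
    ∀ u : TangentSpace 𝓘(ℝ, SkewCoord (2 * n)) A, IsVertical A u → g.inner A h u = 0

/-- The diffeomorphism `SO(2n-1)/U(n-1) = SO(2n)/U(n)` induced by `SO(2n-1) ⊆ SO(2n)` is an
isometry from the homogeneous metric `λ₁ Q|𝔭₁ ⊥ λ₂ Q|𝔭₂` onto the normal homogeneous metric
induced by `g`. The tangent space of `SO(2n-1)/U(n-1)` at the coset of `B` consists of the classes
of the vectors `B Z`, with `Z = X + Y`, `X ∈ 𝔭₁`, `Y ∈ 𝔭₂`, where the homogeneous metric is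
`λ₁ Q(X, X') + λ₂ Q(Y, Y')`. -/
def IsIsometricToNormal (n : ℕ) (g : SO.RiemannianMetric (2 * n)) (lam₁ lam₂ : ℝ) : Prop :=
  ∀ (B : SO (2 * n - 1)), ∀ X ∈ p₁ n, ∀ X' ∈ p₁ n, ∀ Y ∈ p₂ n, ∀ Y' ∈ p₂ n,
    ∀ v v' h h' : TangentSpace 𝓘(ℝ, SkewCoord (2 * n)) (SO.incl (two_mul_sub_one_le n) B),
      SO.toMatrix _ v =
        (SO.incl (two_mul_sub_one_le n) B).1 * padZero (two_mul_sub_one_le n) (X + Y) →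
      SO.toMatrix _ v' =
        (SO.incl (two_mul_sub_one_le n) B).1 * padZero (two_mul_sub_one_le n) (X' + Y') →
      IsHorizontalPart g _ v h → IsHorizontalPart g _ v' h' →
      g.inner _ h h' = lam₁ * Q X X' + lam₂ * Q Y Y'

/-! ### Rotations with prescribed values -/

section Rotations

variable {m : ℕ}

/-! Let `J` be the complex structure of `ℂ^n`. Left invariance reduces the metric to one inner
product `β` on `so(2n)` (`metricForm`), and right invariance makes `β` invariant under conjugation
(`IsBiInvariant.isAdInvariant`). Since `so(4)` is not simple, `β` need not be a multiple of `Q`.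
However, `J` itself lies in `SO(2n)`, so conjugation by it makes `u(n)` orthogonal to the skew
matrices anticommuting with `J`. These are therefore the horizontal space of `SO(2n) → SO(2n)/U(n)`,
whatever the metric, and on them `β` is a multiple of `Q` (`IsAdInvariant.eq_mul_Q`). The proof uses
the matrices `antiWedge J w a`: unitary motions, built as Cayley transforms, show that `β` takes the
value `c |a|²` on them for unit `w` and `a` orthogonal to `w, Jw`, with one constant `c`, and that
they are orthogonal to every anticommuting matrix killing `w`.

The homeomorphism `Φ` exists because `U(n)` acts transitively on the unit sphere of `ℝ^{2n}` and the
stabilizer of `e_{2n}` in it is `U(n-1)`. Bijectivity suffices, as the spaces involved are compact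
and Hausdorff.

The factor `1/2` between the constants is a matter of projection. Matrices in `𝔭₁` anticommute with
`J` and are already horizontal. For `Y ∈ 𝔭₂` the matrices `Y` and `JYJ` have disjoint supports and
equal length, so the horizontal part `½(Y + JYJ)` has half the squared length of `Y` (`Q_antiPart`).
With `β = (c/2) Q` on horizontal matrices this gives `λ₁ = c/2` and `λ₂ = c/4`.

In coordinates, `π(A)` is `-A J Aᵀ e_{2n}` with its vanishing last entry dropped, a quadratic
polynomial in `A`. With `w = J Aᵀ e_{2n}`, its differential sends `AZ` to `-2 A Z w` when `Z`
anticommutes with `J`. The complement of the kernel consists of antiwedges at `w`, where `β(Z, Z') =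
c (Zw · Z'w)`; this matches the round metric because `4 λ₂ = c`. The fibre over `B e_{2n-1}` is `B
SO(2n-2) U(n)`, an image of a connected space. -/

theorem mulVec_dotProduct_transpose (A : Matrix (Fin m) (Fin m) ℝ) (x y : Fin m → ℝ) :
    (A *ᵥ x) ⬝ᵥ y = x ⬝ᵥ (Aᵀ *ᵥ y) := by
  rw [dotProduct_comm, dotProduct_mulVec, dotProduct_comm, mulVec_transpose]

theorem SO.mulVec_dotProduct_mulVec (U : SO m) (x y : Fin m → ℝ) :
    (U.1 *ᵥ x) ⬝ᵥ (U.1 *ᵥ y) = x ⬝ᵥ y := by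
  rw [mulVec_dotProduct_transpose, mulVec_mulVec, SO.transpose_mul, one_mulVec]

theorem SO.cayley_mulVec {X : Matrix (Fin m) (Fin m) ℝ} (h : Xᵀ = -X) {u x : Fin m → ℝ}
    (hu : (1 - X) *ᵥ u = x) : SO.cayley X *ᵥ x = (1 + X) *ᵥ u := by
  rw [← hu, SO.cayley, mulVec_mulVec, mul_assoc, nonsing_inv_mul _ (SO.isUnit_one_sub h), mul_one]

/-- Commutation with `J` passes to the inverse of `1 - X`. Thus the Cayley transform takes `u(n)`
into `U(n)`, which is how all unitary motions below are produced. -/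
theorem SO.cayley_commute {X J : Matrix (Fin m) (Fin m) ℝ} (h : Xᵀ = -X) (hJ : X * J = J * X) :
    SO.cayley X * J = J * SO.cayley X := by
  have hu := SO.isUnit_one_sub h
  have h1 : (1 - X)⁻¹ * J = J * (1 - X)⁻¹ := by
    calc (1 - X)⁻¹ * J = (1 - X)⁻¹ * (J * (1 - X)) * (1 - X)⁻¹ := by
          rw [mul_assoc, mul_assoc, mul_nonsing_inv _ hu, mul_one]
      _ = (1 - X)⁻¹ * ((1 - X) * J) * (1 - X)⁻¹ := by
          rw [mul_sub, sub_mul, hJ, mul_one, one_mul]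
      _ = J * (1 - X)⁻¹ := by rw [← mul_assoc, nonsing_inv_mul _ hu, one_mul]
  rw [SO.cayley, mul_assoc, h1, ← mul_assoc, ← mul_assoc, add_mul, mul_add, hJ, mul_one, one_mul]

/-- A skew-symmetric matrix mapping `u + v` to `v - u` has a Cayley transform mapping `u` to
`v`. -/
theorem SO.cayley_mulVec_eq {X : Matrix (Fin m) (Fin m) ℝ} (h : Xᵀ = -X) {u v : Fin m → ℝ}
    (hX : X *ᵥ (u + v) = v - u) : SO.cayley X *ᵥ u = v := by
  -- The midpoint of `u` and `v` is sent to `u` by `1 - X` and to `v` by `1 + X`.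
  rw [SO.cayley_mulVec h (u := (1 / 2 : ℝ) • (u + v))]
  · rw [add_mulVec, one_mulVec, mulVec_smul, hX]
    ext i; simp; ring
  · rw [sub_mulVec, one_mulVec, mulVec_smul, hX]
    ext i; simp; ring

theorem SO.cayley_mulVec_of_ker {X : Matrix (Fin m) (Fin m) ℝ} (h : Xᵀ = -X) {w : Fin m → ℝ}
    (hX : X *ᵥ w = 0) : SO.cayley X *ᵥ w = w := by
  rw [SO.cayley_mulVec h (u := w)]
  · rw [add_mulVec, one_mulVec, hX, add_zero]
  · rw [sub_mulVec, one_mulVec, hX, sub_zero]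

theorem dotProduct_add_sub {u v : Fin m → ℝ} (h : u ⬝ᵥ u = v ⬝ᵥ v) :
    (v - u) ⬝ᵥ (u + v) = 0 := by
  rw [sub_dotProduct, dotProduct_add, dotProduct_add, dotProduct_comm v u]
  linarith

/-- The special orthogonal group moves `u` to any vector `v ≠ -u` of the same length. -/
theorem SO.exists_mulVec_eq_of_add_ne_zero {u v : Fin m → ℝ} (h : u ⬝ᵥ u = v ⬝ᵥ v)
    (hne : u + v ≠ 0) : ∃ A : SO m, A.1 *ᵥ u = v := by
  set p := u + v
  set q := v - u
  have hp : p ⬝ᵥ p ≠ 0 := fun h0 => hne (dotProduct_self_eq_zero.1 h0)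
  have hqp : q ⬝ᵥ p = 0 := dotProduct_add_sub h
  -- The normalized wedge of `q` and `p` maps `p` to `q`, because equal lengths of `u` and `v` make
  -- `q` and `p` orthogonal.
  set X := (p ⬝ᵥ p)⁻¹ • (vecMulVec q p - vecMulVec p q) with hX
  have hs : Xᵀ = -X := by
    rw [hX, transpose_smul, transpose_sub, transpose_vecMulVec, transpose_vecMulVec, ← smul_neg,
      neg_sub]
  refine ⟨⟨SO.cayley X, SO.cayley_mem hs⟩, SO.cayley_mulVec_eq hs ?_⟩
  change X *ᵥ p = q
  rw [hX, smul_mulVec, sub_mulVec, vecMulVec_mulVec, vecMulVec_mulVec, hqp]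
  ext i
  simp only [MulOpposite.op_zero, zero_smul, sub_zero, Pi.smul_apply, MulOpposite.smul_eq_mul_unop,
    MulOpposite.unop_op, smul_eq_mul]
  field_simp

theorem single_dotProduct_self (i : Fin m) :
    (Pi.single i (1 : ℝ) : Fin m → ℝ) ⬝ᵥ Pi.single i 1 = 1 := by simp

/-- The special orthogonal group acts transitively on the unit sphere. -/
theorem SO.exists_mulVec_eq (hm : 2 ≤ m) {u v : Fin m → ℝ} (hu : u ⬝ᵥ u = 1) (hv : v ⬝ᵥ v = 1) :
    ∃ A : SO m, A.1 *ᵥ u = v := by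
  by_cases hne : u + v = 0
  · obtain ⟨w, hw, hw1, hw2⟩ : ∃ w : Fin m → ℝ, w ⬝ᵥ w = 1 ∧ u + w ≠ 0 ∧ w + v ≠ 0 := by
      let a : Fin m := ⟨0, by omega⟩
      let b : Fin m := ⟨1, by omega⟩
      have hab : a ≠ b := by simp [a, b]
      by_contra! hcon
      have hv' : v = -u := (neg_eq_of_add_eq_zero_right hne).symm
      -- If no intermediate `w` exists, every basis vector is `u` or `-u`. All coordinates of `u`
      -- then have square `1`, so its squared length is `m`, which forces `m = 1`.
      have key : ∀ i : Fin m, u i ^ 2 = 1 := by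
        intro i
        have h1 := hcon (Pi.single i 1) (single_dotProduct_self i)
        by_cases h0 : u + Pi.single i 1 = 0
        · have := congrFun h0 i
          simp at this
          nlinarith
        · have := congrFun (h1 h0) i
          rw [hv'] at this
          simp at this
          nlinarith
      have hsum : u ⬝ᵥ u = ∑ _i : Fin m, (1 : ℝ) := by
        simp only [dotProduct]
        exact Finset.sum_congr rfl fun i _ => by rw [← sq, key]
      rw [hu] at hsum
      simp at hsum
      have : m = 1 := by exact_mod_cast hsum.symm
      omega
    obtain ⟨A, hA⟩ := SO.exists_mulVec_eq_of_add_ne_zero (hu.trans hw.symm) hw1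
    obtain ⟨B, hB⟩ := SO.exists_mulVec_eq_of_add_ne_zero (hw.trans hv.symm) hw2
    exact ⟨B * A, by rw [Submonoid.coe_mul, ← mulVec_mulVec, hA, hB]⟩
  · exact SO.exists_mulVec_eq_of_add_ne_zero (hu.trans hv.symm) hne

end Rotations

/-! ### Unitary rotations with respect to a complex structure -/

/-- A skew-symmetric matrix of square `-1`. -/
structure IsComplexStructure {m : ℕ} (J : Matrix (Fin m) (Fin m) ℝ) : Prop where
  transpose_eq : Jᵀ = -J
  mul_self : J * J = -1

namespace IsComplexStructure

variable {m : ℕ} {J : Matrix (Fin m) (Fin m) ℝ} (hJ : IsComplexStructure J)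

theorem mulVec_mulVec_self (hJ : IsComplexStructure J) (x : Fin m → ℝ) :
    J *ᵥ (J *ᵥ x) = -x := by
  rw [mulVec_mulVec, hJ.mul_self, neg_mulVec, one_mulVec]

theorem mulVec_dotProduct (hJ : IsComplexStructure J) (x y : Fin m → ℝ) :
    (J *ᵥ x) ⬝ᵥ y = -(x ⬝ᵥ (J *ᵥ y)) := by
  rw [mulVec_dotProduct_transpose, hJ.transpose_eq, neg_mulVec, dotProduct_neg]

theorem mulVec_dotProduct_mulVec (hJ : IsComplexStructure J) (x y : Fin m → ℝ) :
    (J *ᵥ x) ⬝ᵥ (J *ᵥ y) = x ⬝ᵥ y := by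
  rw [hJ.mulVec_dotProduct, hJ.mulVec_mulVec_self, dotProduct_neg, neg_neg]

theorem mulVec_dotProduct_self (hJ : IsComplexStructure J) (x : Fin m → ℝ) :
    (J *ᵥ x) ⬝ᵥ x = 0 := by
  have h := hJ.mulVec_dotProduct x x
  rw [dotProduct_comm x] at h
  linarith

theorem dotProduct_mulVec_self (hJ : IsComplexStructure J) (x : Fin m → ℝ) :
    x ⬝ᵥ (J *ᵥ x) = 0 := by
  rw [dotProduct_comm, hJ.mulVec_dotProduct_self]

/-- `J` is its own Cayley transform: `(1 - J)⁻¹ = ½(1 + J)` and `½(1 + J)² = J`. In particular no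
separate computation of the determinant is needed. -/
theorem mem_specialOrthogonalGroup (hJ : IsComplexStructure J) :
    J ∈ Matrix.specialOrthogonalGroup (Fin m) ℝ := by
  have h := SO.cayley_mem hJ.transpose_eq
  have h1 : (1 - J) * ((1 / 2 : ℝ) • (1 + J)) = 1 := by
    rw [mul_smul_comm, mul_add, sub_mul, sub_mul, hJ.mul_self, mul_one, mul_one, one_mul]
    ext i j
    simp
    ring
  rw [SO.cayley, inv_eq_right_inv h1, mul_smul_comm, mul_add, add_mul, add_mul, hJ.mul_self,
    mul_one, mul_one, one_mul] at h
  convert h using 1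
  ext i j
  simp
  ring

theorem vecMulVec_mul (hJ : IsComplexStructure J) (x y : Fin m → ℝ) :
    vecMulVec x y * J = -vecMulVec x (J *ᵥ y) := by
  rw [Matrix.vecMulVec_mul, ← mulVec_transpose, hJ.transpose_eq, neg_mulVec, vecMulVec_neg]

/-- Rotations commuting with `J` move `u` to any vector `v ≠ -u` of the same length, fixing the
complex orthogonal complement of `u` and `v`. -/
theorem exists_mulVec_eq_of_add_ne_zero (hJ : IsComplexStructure J) {u v : Fin m → ℝ}
    (h : u ⬝ᵥ u = v ⬝ᵥ v) (hne : u + v ≠ 0) :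
    ∃ A : SO m, A.1 * J = J * A.1 ∧ A.1 *ᵥ u = v ∧
      ∀ w : Fin m → ℝ, u ⬝ᵥ w = 0 → v ⬝ᵥ w = 0 → u ⬝ᵥ (J *ᵥ w) = 0 → v ⬝ᵥ (J *ᵥ w) = 0 →
        A.1 *ᵥ w = w := by
  set p := u + v with hp_def
  set q := v - u with hq_def
  have hp : p ⬝ᵥ p ≠ 0 := fun h0 => hne (dotProduct_self_eq_zero.1 h0)
  have hqp : q ⬝ᵥ p = 0 := dotProduct_add_sub h
  -- Adding the wedge of `Jq` and `Jp` makes the wedge of `q` and `p` commute with `J`, but its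
  -- value at `p` acquires the error `-(Jq · p) Jp`. The term with `t`, which also commutes with
  -- `J`, cancels it.
  set Y := vecMulVec q p - vecMulVec p q + vecMulVec (J *ᵥ q) (J *ᵥ p) -
    vecMulVec (J *ᵥ p) (J *ᵥ q) with hY
  set t := (p ⬝ᵥ p)⁻¹ * ((J *ᵥ q) ⬝ᵥ p)
  set X := (p ⬝ᵥ p)⁻¹ • (Y + t • (vecMulVec (J *ᵥ p) p - vecMulVec p (J *ᵥ p))) with hX
  have hs : Xᵀ = -X := by
    rw [hX, hY]
    simp only [transpose_smul, transpose_sub, transpose_add, transpose_vecMulVec]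
    module
  have hc : X * J = J * X := by
    rw [hX, hY]
    simp only [smul_mul_assoc, mul_smul_comm, add_mul, sub_mul, mul_add, mul_sub, hJ.vecMulVec_mul,
      mul_vecMulVec, hJ.mulVec_mulVec_self, vecMulVec_neg, neg_vecMulVec]
    module
  have hXp : X *ᵥ p = q := by
    rw [hX, hY]
    simp only [smul_mulVec, sub_mulVec, add_mulVec, vecMulVec_mulVec, hqp,
      hJ.mulVec_dotProduct_self]
    ext i
    simp [t]
    field_simp
    ring
  refine ⟨⟨SO.cayley X, SO.cayley_mem hs⟩, SO.cayley_commute hs hc, SO.cayley_mulVec_eq hs hXp,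
    fun w h1 h2 h3 h4 => SO.cayley_mulVec_of_ker hs ?_⟩
  rw [hX, hY]
  simp only [smul_mulVec, sub_mulVec, add_mulVec, vecMulVec_mulVec, hJ.mulVec_dotProduct, hp_def,
    hq_def, add_dotProduct, sub_dotProduct, h1, h2, h3, h4]
  simp

/-- Rotations commuting with `J` act transitively on the unit sphere. -/
theorem exists_mulVec_eq (hJ : IsComplexStructure J) {u v : Fin m → ℝ}
    (h : u ⬝ᵥ u = v ⬝ᵥ v) : ∃ A : SO m, A.1 * J = J * A.1 ∧ A.1 *ᵥ u = v := by
  by_cases hne : u + v = 0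
  -- Here `v = -u`, and `J² = -1` does the job.
  · refine ⟨⟨J, hJ.mem_specialOrthogonalGroup⟩ * ⟨J, hJ.mem_specialOrthogonalGroup⟩, ?_, ?_⟩
    · rw [Submonoid.coe_mul, mul_assoc]
    · rw [Submonoid.coe_mul, ← mulVec_mulVec, hJ.mulVec_mulVec_self]
      exact neg_eq_of_add_eq_zero_right hne
  · obtain ⟨A, h1, h2, -⟩ := hJ.exists_mulVec_eq_of_add_ne_zero h hne
    exact ⟨A, h1, h2⟩

/-- Up to a factor `2`, the component of `Z` that commutes with `J`. -/
theorem commute_part (hJ : IsComplexStructure J) (Z : Matrix (Fin m) (Fin m) ℝ) :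
    (Z - J * Z * J) * J = J * (Z - J * Z * J) := by
  rw [sub_mul, mul_sub, mul_assoc (J * Z), hJ.mul_self, ← mul_assoc, ← mul_assoc, hJ.mul_self]
  simp only [mul_neg, mul_one, neg_mul, one_mul, sub_neg_eq_add]
  abel

theorem transpose_conj (hJ : IsComplexStructure J) {Z : Matrix (Fin m) (Fin m) ℝ}
    (hZ : Zᵀ = -Z) : (J * Z * J)ᵀ = -(J * Z * J) := by
  rw [transpose_mul, transpose_mul, hZ, hJ.transpose_eq]
  noncomm_ring

end IsComplexStructure

/-! ### Skew-symmetric matrices anticommuting with a complex structure -/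

/-- The skew-symmetric matrices anticommuting with `J`. -/
structure IsAntiSkew {m : ℕ} (J X : Matrix (Fin m) (Fin m) ℝ) : Prop where
  transpose_eq : Xᵀ = -X
  anticomm : X * J = -(J * X)

/-- The skew-symmetric matrix anticommuting with `J` built from two vectors. -/
def antiWedge {m : ℕ} (J : Matrix (Fin m) (Fin m) ℝ) (w a : Fin m → ℝ) :
    Matrix (Fin m) (Fin m) ℝ :=
  vecMulVec a w - vecMulVec w a - vecMulVec (J *ᵥ a) (J *ᵥ w) + vecMulVec (J *ᵥ w) (J *ᵥ a)

section AntiWedge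

variable {m : ℕ} {J : Matrix (Fin m) (Fin m) ℝ}

theorem IsAntiSkew.sub {X Y : Matrix (Fin m) (Fin m) ℝ} (hX : IsAntiSkew J X)
    (hY : IsAntiSkew J Y) : IsAntiSkew J (X - Y) := by
  refine ⟨?_, ?_⟩
  · rw [transpose_sub, hX.transpose_eq, hY.transpose_eq]
    abel
  · rw [sub_mul, mul_sub, hX.anticomm, hY.anticomm]
    abel

theorem IsAntiSkew.dotProduct_mulVec_self {X : Matrix (Fin m) (Fin m) ℝ} (hX : IsAntiSkew J X)
    (w : Fin m → ℝ) : (X *ᵥ w) ⬝ᵥ w = 0 := by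
  have h := mulVec_dotProduct_transpose X w w
  rw [hX.transpose_eq, neg_mulVec, dotProduct_neg, dotProduct_comm w] at h
  linarith

/-- The product `XJ` is again skew-symmetric. Together with the skewness of `X`, this places `Xw` in
the complement of the complex line of `w`. -/
theorem IsAntiSkew.dotProduct_mulVec_conj (hJ : IsComplexStructure J)
    {X : Matrix (Fin m) (Fin m) ℝ} (hX : IsAntiSkew J X)
    (w : Fin m → ℝ) : (X *ᵥ w) ⬝ᵥ (J *ᵥ w) = 0 := by
  have h := mulVec_dotProduct_transpose X w (J *ᵥ w)
  rw [hX.transpose_eq, mulVec_mulVec, neg_mul, hX.anticomm, neg_neg, ← mulVec_mulVec,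
    dotProduct_comm w, hJ.mulVec_dotProduct] at h
  linarith

theorem antiWedge_isAntiSkew (hJ : IsComplexStructure J) (w a : Fin m → ℝ) :
    IsAntiSkew J (antiWedge J w a) := by
  refine ⟨?_, ?_⟩
  · simp only [antiWedge, transpose_sub, transpose_add, transpose_vecMulVec]
    abel
  · simp only [antiWedge, add_mul, sub_mul, mul_add, mul_sub, hJ.vecMulVec_mul, mul_vecMulVec,
      hJ.mulVec_mulVec_self, vecMulVec_neg, neg_vecMulVec]
    abel

theorem antiWedge_neg_left (w a : Fin m → ℝ) : antiWedge J (-w) a = -antiWedge J w a := by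
  simp only [antiWedge, mulVec_neg, vecMulVec_neg, neg_vecMulVec]
  abel

theorem antiWedge_neg_right (w a : Fin m → ℝ) : antiWedge J w (-a) = -antiWedge J w a := by
  simp only [antiWedge, mulVec_neg, vecMulVec_neg, neg_vecMulVec]
  abel

theorem antiWedge_add_right (w a b : Fin m → ℝ) :
    antiWedge J w (a + b) = antiWedge J w a + antiWedge J w b := by
  simp only [antiWedge, mulVec_add, vecMulVec_add, add_vecMulVec]
  abel

theorem antiWedge_smul_right (w a : Fin m → ℝ) (c : ℝ) :
    antiWedge J w (c • a) = c • antiWedge J w a := by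
  simp only [antiWedge, mulVec_smul, vecMulVec_smul, smul_vecMulVec]
  module

theorem antiWedge_conj {U : Matrix (Fin m) (Fin m) ℝ} (hU : U * J = J * U) (w a : Fin m → ℝ) :
    U * antiWedge J w a * Uᵀ = antiWedge J (U *ᵥ w) (U *ᵥ a) := by
  simp only [antiWedge, mul_add, mul_sub, add_mul, sub_mul, mul_vecMulVec, Matrix.vecMulVec_mul,
    vecMul_transpose, mulVec_mulVec, hU]

/-- An anticommuting `X` therefore agrees at the unit vector `w` with `antiWedge J w (X *ᵥ w)`, so
their difference kills `w`. -/
theorem antiWedge_mulVec (hJ : IsComplexStructure J) {w a : Fin m → ℝ} (hw : w ⬝ᵥ w = 1)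
    (h1 : a ⬝ᵥ w = 0) (h2 : a ⬝ᵥ (J *ᵥ w) = 0) : antiWedge J w a *ᵥ w = a := by
  simp only [antiWedge, sub_mulVec, add_mulVec, vecMulVec_mulVec, hw, h1, hJ.mulVec_dotProduct_self,
    hJ.mulVec_dotProduct a, h2]
  simp

/-- Each of the four terms of the antiwedge sums to `Y`: the first two by expansion in columns and
`Yᵀ = -Y`, the last two because `JYJ = Y`. This reduces a bilinear form to its values on antiwedges.
-/
theorem sum_antiWedge_single (hJ : IsComplexStructure J) {Y : Matrix (Fin m) (Fin m) ℝ}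
    (hY : IsAntiSkew J Y) :
    ∑ i, antiWedge J (Pi.single i 1) (Y *ᵥ Pi.single i 1) = (4 : ℝ) • Y := by
  have h1 : ∀ A : Matrix (Fin m) (Fin m) ℝ,
      ∑ i, vecMulVec (A *ᵥ Pi.single i 1) (Pi.single i 1) = A := by
    intro A
    ext k l
    simp [Matrix.sum_apply, vecMulVec_apply, Pi.single_apply]
  have h2 : ∀ A : Matrix (Fin m) (Fin m) ℝ,
      ∑ i, vecMulVec (Pi.single i 1) (A *ᵥ Pi.single i 1) = Aᵀ := by
    intro A
    ext k l
    simp [Matrix.sum_apply, vecMulVec_apply, Pi.single_apply]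
  have h3 : ∀ A : Matrix (Fin m) (Fin m) ℝ, ∀ x y : Fin m → ℝ,
      vecMulVec x (A *ᵥ y) = vecMulVec x y * Aᵀ := by
    intro A x y
    rw [Matrix.vecMulVec_mul, vecMul_transpose]
  have h4 : ∑ i, vecMulVec (J *ᵥ (Y *ᵥ Pi.single i 1)) (J *ᵥ Pi.single i 1) = J * Y * Jᵀ := by
    simp only [h3 J, ← Finset.sum_mul, mulVec_mulVec, h1]
  have h5 : ∑ i, vecMulVec (J *ᵥ Pi.single i 1) (J *ᵥ (Y *ᵥ Pi.single i 1)) = J * Yᵀ * Jᵀ := by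
    simp only [mulVec_mulVec, ← mul_vecMulVec, ← Finset.mul_sum, h2, transpose_mul, mul_assoc]
  simp only [antiWedge, Finset.sum_add_distrib, Finset.sum_sub_distrib, h1, h2, h4, h5,
    hY.transpose_eq, hJ.transpose_eq]
  have h6 : J * Y * J = Y := by
    rw [mul_assoc, hY.anticomm, mul_neg, ← mul_assoc, hJ.mul_self, neg_mul, one_mul, neg_neg]
  simp only [mul_neg, neg_mul, h6]
  module

end AntiWedge

/-! ### Invariant inner products on skew-symmetric matrices -/

/-- A bilinear form on matrices that restricts to a conjugation-invariant inner product on the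
skew-symmetric ones. -/
structure IsAdInvariant {m : ℕ}
    (β : Matrix (Fin m) (Fin m) ℝ →ₗ[ℝ] Matrix (Fin m) (Fin m) ℝ →ₗ[ℝ] ℝ) : Prop where
  symm : ∀ X Y, β X Y = β Y X
  pos : ∀ X, Xᵀ = -X → X ≠ 0 → 0 < β X X
  conj : ∀ (U : SO m) (X Y : Matrix (Fin m) (Fin m) ℝ), Xᵀ = -X → Yᵀ = -Y →
    β (U.1 * X * (U.1)ᵀ) (U.1 * Y * (U.1)ᵀ) = β X Y

namespace IsAdInvariant

variable {m : ℕ} {β : Matrix (Fin m) (Fin m) ℝ →ₗ[ℝ] Matrix (Fin m) (Fin m) ℝ →ₗ[ℝ] ℝ}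
  {J : Matrix (Fin m) (Fin m) ℝ}

theorem eq_zero (hβ : IsAdInvariant β) {X : Matrix (Fin m) (Fin m) ℝ} (hX : Xᵀ = -X)
    (h : β X X = 0) : X = 0 := by
  by_contra h0
  exact (hβ.pos X hX h0).ne' h

/-- Matrices commuting with `J` are orthogonal to those anticommuting with `J`. -/
theorem orthogonal (hβ : IsAdInvariant β) (hJ : IsComplexStructure J)
    {X Y : Matrix (Fin m) (Fin m) ℝ} (hX : Xᵀ = -X) (hXJ : X * J = J * X) (hY : IsAntiSkew J Y) :
    β X Y = 0 := by
  -- Conjugation by `J` fixes `X` and negates `Y`.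
  have h := hβ.conj ⟨J, hJ.mem_specialOrthogonalGroup⟩ X Y hX hY.transpose_eq
  have h1 : J * X * Jᵀ = X := by
    rw [hJ.transpose_eq, ← hXJ, mul_neg, mul_assoc, hJ.mul_self, mul_neg, neg_neg, mul_one]
  have h2 : J * Y * Jᵀ = -Y := by
    rw [hJ.transpose_eq, mul_neg, mul_assoc, hY.anticomm, mul_neg, ← mul_assoc, hJ.mul_self,
      neg_mul, one_mul, neg_neg]
  simp only [h1, h2, map_neg] at h
  linarith

theorem antiWedge_conj (hβ : IsAdInvariant β) (hJ : IsComplexStructure J) {U : SO m}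
    (hU : U.1 * J = J * U.1) (w a w' a' : Fin m → ℝ) :
    β (antiWedge J (U.1 *ᵥ w) (U.1 *ᵥ a)) (antiWedge J (U.1 *ᵥ w') (U.1 *ᵥ a')) =
      β (antiWedge J w a) (antiWedge J w' a') := by
  rw [← _root_.antiWedge_conj hU, ← _root_.antiWedge_conj hU]
  exact hβ.conj U _ _ (antiWedge_isAntiSkew hJ w a).transpose_eq
    (antiWedge_isAntiSkew hJ w' a').transpose_eq

/-- A unitary `U` with `Uw = Jw` that fixes the complement of `w, Jw` fixes `a`, and it fixes `K`
under conjugation because `K` lives on that complement. Its square sends `w` to `-w`, so the value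
of the form equals its own negative. -/
theorem antiWedge_ker (hβ : IsAdInvariant β) (hJ : IsComplexStructure J) {w a : Fin m → ℝ}
    (hw : w ⬝ᵥ w = 1) (h1 : a ⬝ᵥ w = 0) (h2 : a ⬝ᵥ (J *ᵥ w) = 0)
    {K : Matrix (Fin m) (Fin m) ℝ} (hK : IsAntiSkew J K) (hKw : K *ᵥ w = 0) :
    β (antiWedge J w a) K = 0 := by
  have hne : w + J *ᵥ w ≠ 0 := by
    intro h0
    have := congrArg (fun x => w ⬝ᵥ x) h0
    simp only [dotProduct_add, hw, hJ.dotProduct_mulVec_self, dotProduct_zero] at this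
    norm_num at this
  obtain ⟨U, hU, hUw, hUx⟩ := hJ.exists_mulVec_eq_of_add_ne_zero
    (hJ.mulVec_dotProduct_mulVec w w).symm hne
  have hfix : ∀ x : Fin m → ℝ, x ⬝ᵥ w = 0 → x ⬝ᵥ (J *ᵥ w) = 0 → U.1 *ᵥ x = x := by
    intro x hx hx'
    refine hUx x ?_ ?_ ?_ ?_
    · rw [dotProduct_comm, hx]
    · rw [dotProduct_comm, hx']
    · rw [dotProduct_comm, hJ.mulVec_dotProduct, hx', neg_zero]
    · rw [hJ.mulVec_dotProduct_mulVec, dotProduct_comm, hx]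
  -- The columns of `K` are orthogonal to `w` and `Jw`: `K` is skew and kills `w`, hence also `Jw`
  -- by anticommutation.
  have hUK : U.1 * K = K := by
    refine ext_of_mulVec_single fun i => ?_
    rw [← mulVec_mulVec]
    refine hfix _ ?_ ?_
    · rw [mulVec_dotProduct_transpose, hK.transpose_eq, neg_mulVec, hKw, neg_zero, dotProduct_zero]
    · rw [mulVec_dotProduct_transpose, hK.transpose_eq, mulVec_mulVec, neg_mul, hK.anticomm, neg_neg,
        ← mulVec_mulVec, hKw, mulVec_zero, dotProduct_zero]
  have hKU : U.1 * K * (U.1)ᵀ = K := by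
    have := congrArg transpose hUK
    rw [transpose_mul, hK.transpose_eq, neg_mul, neg_inj] at this
    rw [hUK, this]
  have step : ∀ v, β (antiWedge J (U.1 *ᵥ v) a) K = β (antiWedge J v a) K := by
    intro v
    have := hβ.conj U _ _ (antiWedge_isAntiSkew hJ v a).transpose_eq hK.transpose_eq
    rwa [_root_.antiWedge_conj hU, hKU, hfix a h1 h2] at this
  -- Two applications of `U` are used because the motion from `w` directly to `-w` is excluded in
  -- `exists_mulVec_eq_of_add_ne_zero`.
  have h3 := step w
  have h4 := step (U.1 *ᵥ w)
  rw [hUw, mulVec_mulVec, hU, ← mulVec_mulVec, hUw, hJ.mulVec_mulVec_self, antiWedge_neg_left,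
    ← hUw, h3, map_neg, LinearMap.neg_apply] at h4
  linarith

/-- The value of an invariant inner product on a unit antiwedge is independent of the unit
vectors. -/
theorem antiWedge_self_of_unit (hβ : IsAdInvariant β) (hJ : IsComplexStructure J)
    {w₀ a₀ w a : Fin m → ℝ} (hw₀ : w₀ ⬝ᵥ w₀ = 1) (ha₀ : a₀ ⬝ᵥ a₀ = 1) (h1₀ : a₀ ⬝ᵥ w₀ = 0)
    (h2₀ : a₀ ⬝ᵥ (J *ᵥ w₀) = 0) (hw : w ⬝ᵥ w = 1) (ha : a ⬝ᵥ a = 1) (h1 : a ⬝ᵥ w = 0)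
    (h2 : a ⬝ᵥ (J *ᵥ w) = 0) :
    β (antiWedge J w a) (antiWedge J w a) = β (antiWedge J w₀ a₀) (antiWedge J w₀ a₀) := by
  obtain ⟨U, hU, hUw⟩ := hJ.exists_mulVec_eq (hw.trans hw₀.symm)
  rw [← hβ.antiWedge_conj hJ hU, hUw]
  set b := U.1 *ᵥ a with hb_def
  have hb : b ⬝ᵥ b = 1 := by rw [hb_def, SO.mulVec_dotProduct_mulVec, ha]
  have hb1 : b ⬝ᵥ w₀ = 0 := by rw [hb_def, ← hUw, SO.mulVec_dotProduct_mulVec, h1]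
  have hb2 : b ⬝ᵥ (J *ᵥ w₀) = 0 := by
    rw [hb_def, ← hUw, mulVec_mulVec, ← hU, ← mulVec_mulVec, SO.mulVec_dotProduct_mulVec, h2]
  -- After `w` has been moved to `w₀`, the remaining motion takes `b` to `a₀` while fixing `w₀`. In
  -- the antipodal case the sign drops out of the quadratic expression.
  by_cases hne : b + a₀ = 0
  · rw [eq_neg_of_add_eq_zero_left hne, antiWedge_neg_right]
    simp
  · obtain ⟨V, hV, hVb, hVx⟩ := hJ.exists_mulVec_eq_of_add_ne_zero (hb.trans ha₀.symm) hne
    rw [← hβ.antiWedge_conj hJ hV, hVb, hVx w₀ hb1 h1₀ hb2 h2₀]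

theorem antiWedge_self (hβ : IsAdInvariant β) (hJ : IsComplexStructure J)
    {w₀ a₀ w a : Fin m → ℝ} (hw₀ : w₀ ⬝ᵥ w₀ = 1) (ha₀ : a₀ ⬝ᵥ a₀ = 1) (h1₀ : a₀ ⬝ᵥ w₀ = 0)
    (h2₀ : a₀ ⬝ᵥ (J *ᵥ w₀) = 0) (hw : w ⬝ᵥ w = 1) (h1 : a ⬝ᵥ w = 0) (h2 : a ⬝ᵥ (J *ᵥ w) = 0) :
    β (antiWedge J w a) (antiWedge J w a) =
      β (antiWedge J w₀ a₀) (antiWedge J w₀ a₀) * (a ⬝ᵥ a) := by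
  by_cases ha : a = 0
  · subst ha
    have : antiWedge J w 0 = 0 := by simp [antiWedge]
    simp [this]
  · set r := Real.sqrt (a ⬝ᵥ a)
    have hr2 : r * r = a ⬝ᵥ a :=
      Real.mul_self_sqrt (Finset.sum_nonneg fun i _ => mul_self_nonneg (a i))
    have hr : r ≠ 0 := by
      intro h0
      rw [h0, zero_mul] at hr2
      exact ha (dotProduct_self_eq_zero.1 hr2.symm)
    have hb : (r⁻¹ • a) ⬝ᵥ (r⁻¹ • a) = 1 := by
      rw [smul_dotProduct, dotProduct_smul, ← hr2]
      simp only [smul_eq_mul]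
      field_simp
    have key := hβ.antiWedge_self_of_unit hJ hw₀ ha₀ h1₀ h2₀ hw hb
      (by rw [smul_dotProduct, h1, smul_zero]) (by rw [smul_dotProduct, h2, smul_zero])
    rw [antiWedge_smul_right, map_smul, map_smul, LinearMap.smul_apply] at key
    rw [← key, ← hr2]
    simp only [smul_eq_mul]
    field_simp

/-- Polarization of `antiWedge_self` at `a + b`. -/
theorem antiWedge_apply (hβ : IsAdInvariant β) (hJ : IsComplexStructure J)
    {w₀ a₀ w a b : Fin m → ℝ} (hw₀ : w₀ ⬝ᵥ w₀ = 1) (ha₀ : a₀ ⬝ᵥ a₀ = 1) (h1₀ : a₀ ⬝ᵥ w₀ = 0)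
    (h2₀ : a₀ ⬝ᵥ (J *ᵥ w₀) = 0) (hw : w ⬝ᵥ w = 1) (ha1 : a ⬝ᵥ w = 0) (ha2 : a ⬝ᵥ (J *ᵥ w) = 0)
    (hb1 : b ⬝ᵥ w = 0) (hb2 : b ⬝ᵥ (J *ᵥ w) = 0) :
    β (antiWedge J w a) (antiWedge J w b) =
      β (antiWedge J w₀ a₀) (antiWedge J w₀ a₀) * (a ⬝ᵥ b) := by
  have h1 := hβ.antiWedge_self hJ hw₀ ha₀ h1₀ h2₀ hw ha1 ha2
  have h2 := hβ.antiWedge_self hJ hw₀ ha₀ h1₀ h2₀ hw hb1 hb2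
  have h3 := hβ.antiWedge_self hJ hw₀ ha₀ h1₀ h2₀ hw (a := a + b)
    (by rw [add_dotProduct, ha1, hb1, add_zero]) (by rw [add_dotProduct, ha2, hb2, add_zero])
  rw [antiWedge_add_right] at h3
  simp only [map_add, LinearMap.add_apply, add_dotProduct, dotProduct_add] at h3
  rw [hβ.symm (antiWedge J w b), dotProduct_comm b a] at h3
  linarith

/-- On matrices anticommuting with `J`, an invariant inner product evaluates antiwedges
through their action on a unit vector. -/
theorem apply_antiWedge (hβ : IsAdInvariant β) (hJ : IsComplexStructure J)
    {w₀ a₀ w b : Fin m → ℝ} (hw₀ : w₀ ⬝ᵥ w₀ = 1) (ha₀ : a₀ ⬝ᵥ a₀ = 1) (h1₀ : a₀ ⬝ᵥ w₀ = 0)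
    (h2₀ : a₀ ⬝ᵥ (J *ᵥ w₀) = 0) (hw : w ⬝ᵥ w = 1)
    (hb1 : b ⬝ᵥ w = 0) (hb2 : b ⬝ᵥ (J *ᵥ w) = 0)
    {X : Matrix (Fin m) (Fin m) ℝ} (hX : IsAntiSkew J X) :
    β X (antiWedge J w b) =
      β (antiWedge J w₀ a₀) (antiWedge J w₀ a₀) * ((X *ᵥ w) ⬝ᵥ b) := by
  have ha1 := hX.dotProduct_mulVec_self w
  have ha2 := hX.dotProduct_mulVec_conj hJ w
  -- `X` may be replaced by the antiwedge with the same value at `w`: the difference kills `w` and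
  -- is orthogonal to antiwedges at `w`.
  have hK := hβ.antiWedge_ker hJ hw hb1 hb2 (hX.sub (antiWedge_isAntiSkew hJ w (X *ᵥ w)))
    (by rw [sub_mulVec, antiWedge_mulVec hJ hw ha1 ha2, sub_self])
  rw [← hβ.antiWedge_apply hJ hw₀ ha₀ h1₀ h2₀ hw ha1 ha2 hb1 hb2, hβ.symm X, ← sub_eq_zero,
    hβ.symm (antiWedge J w (X *ᵥ w)), ← map_sub, hK]

/-- On the matrices anticommuting with `J` there is only one invariant inner product up to
scaling. -/
theorem eq_mul_Q (hβ : IsAdInvariant β) (hJ : IsComplexStructure J)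
    {w₀ a₀ : Fin m → ℝ} (hw₀ : w₀ ⬝ᵥ w₀ = 1) (ha₀ : a₀ ⬝ᵥ a₀ = 1) (h1₀ : a₀ ⬝ᵥ w₀ = 0)
    (h2₀ : a₀ ⬝ᵥ (J *ᵥ w₀) = 0) {X Y : Matrix (Fin m) (Fin m) ℝ} (hX : IsAntiSkew J X)
    (hY : IsAntiSkew J Y) :
    β X Y = β (antiWedge J w₀ a₀) (antiWedge J w₀ a₀) / 2 * Q X Y := by
  -- With `4Y` expanded into antiwedges at the basis vectors, the sum of `Xe_i · Ye_i` is `-tr(XY) =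
  -- 2 Q(X, Y)`.
  have h4 : β X ((4 : ℝ) • Y) =
      β (antiWedge J w₀ a₀) (antiWedge J w₀ a₀) * (2 * Q X Y) := by
    rw [← sum_antiWedge_single hJ hY, map_sum]
    simp_rw [fun i => hβ.apply_antiWedge hJ hw₀ ha₀ h1₀ h2₀ (single_dotProduct_self i)
      (hY.dotProduct_mulVec_self _) (hY.dotProduct_mulVec_conj hJ _) hX]
    rw [← Finset.mul_sum]
    congr 1
    have : ∀ i, (X *ᵥ Pi.single i 1) ⬝ᵥ (Y *ᵥ Pi.single i 1) = -((X * Y) i i) := by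
      intro i
      rw [mulVec_dotProduct_transpose, hX.transpose_eq, neg_mulVec, mulVec_mulVec]
      simp
    simp_rw [this]
    rw [Q, trace, Finset.sum_neg_distrib]
    simp
  rw [map_smul, smul_eq_mul] at h4
  linarith

end IsAdInvariant

/-! ### Block inclusions in coordinates -/

section Blocks

variable {m M N : ℕ}

theorem blockEquiv_inl_val (h : m ≤ M) (a : Fin m) : (blockEquiv h (Sum.inl a)).val = a.val := by
  simp [blockEquiv]

theorem blockEquiv_inr_val (h : m ≤ M) (a : Fin (M - m)) :
    (blockEquiv h (Sum.inr a)).val = m + a.val := by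
  simp [blockEquiv]

theorem padZero_apply (h : m ≤ M) (X : Matrix (Fin m) (Fin m) ℝ) (i j : Fin M) :
    padZero h X i j = if hij : i.val < m ∧ j.val < m then X ⟨i, hij.1⟩ ⟨j, hij.2⟩ else 0 := by
  obtain ⟨x, rfl⟩ := (blockEquiv h).surjective i
  obtain ⟨y, rfl⟩ := (blockEquiv h).surjective j
  rcases x with x | x <;> rcases y with y | y <;>
    simp [padZero, blockEquiv_inl_val, blockEquiv_inr_val]

theorem SO.incl_apply (h : m ≤ M) (A : SO m) (i j : Fin M) :
    (SO.incl h A).1 i j = if hij : i.val < m ∧ j.val < m then A.1 ⟨i, hij.1⟩ ⟨j, hij.2⟩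
      else if i = j then 1 else 0 := by
  have h0 : (SO.incl h A).1 = reindex (blockEquiv h) (blockEquiv h) (fromBlocks A.1 0 0 1) := rfl
  rw [h0]
  obtain ⟨x, rfl⟩ := (blockEquiv h).surjective i
  obtain ⟨y, rfl⟩ := (blockEquiv h).surjective j
  rcases x with x | x <;> rcases y with y | y <;>
    simp [blockEquiv_inl_val, blockEquiv_inr_val, Matrix.one_apply]

theorem SO.incl_incl (h : m ≤ M) (h' : M ≤ N) (A : SO m) :
    SO.incl h' (SO.incl h A) = SO.incl (h.trans h') A := by
  apply Subtype.ext
  ext i j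
  simp only [SO.incl_apply, Fin.ext_iff]
  split_ifs <;> first | rfl | omega

theorem padZero_padZero (h : m ≤ M) (h' : M ≤ N) (X : Matrix (Fin m) (Fin m) ℝ) :
    padZero h' (padZero h X) = padZero (h.trans h') X := by
  ext i j
  simp only [padZero_apply]
  split_ifs <;> first | rfl | omega

theorem SO.incl_castLE (h : m ≤ M) (A : SO m) (i j : Fin m) :
    (SO.incl h A).1 (Fin.castLE h i) (Fin.castLE h j) = A.1 i j := by
  simp [SO.incl_apply]

theorem padZero_castLE (h : m ≤ M) (X : Matrix (Fin m) (Fin m) ℝ) (i j : Fin m) :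
    padZero h X (Fin.castLE h i) (Fin.castLE h j) = X i j := by
  simp [padZero_apply]

theorem SO.incl_injective (h : m ≤ M) : Function.Injective (SO.incl h) := by
  intro A B hAB
  apply Subtype.ext
  ext i j
  have := congrArg (fun C : SO M => C.1 (Fin.castLE h i) (Fin.castLE h j)) hAB
  simpa [SO.incl_apply] using this

theorem padZero_add (h : m ≤ M) (X Y : Matrix (Fin m) (Fin m) ℝ) :
    padZero h (X + Y) = padZero h X + padZero h Y := by
  ext i j
  simp only [padZero_apply, Matrix.add_apply]
  split_ifs <;> simp

theorem padZero_transpose (h : m ≤ M) {X : Matrix (Fin m) (Fin m) ℝ} (hX : Xᵀ = -X) :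
    (padZero h X)ᵀ = -padZero h X := by
  ext i j
  simp only [padZero_apply, Matrix.neg_apply, transpose_apply]
  split_ifs with h1 h2 h3
  · exact congrFun (congrFun hX _) _
  · omega
  · omega
  · simp

/-- The trace against a padded matrix sees only the upper left block. -/
theorem Q_padZero_right (h : m ≤ M) (Y : Matrix (Fin M) (Fin M) ℝ)
    (X : Matrix (Fin m) (Fin m) ℝ) :
    Q Y (padZero h X) = Q (Y.submatrix (Fin.castLE h) (Fin.castLE h)) X := by
  have htr : ∀ A : Matrix (Fin m ⊕ Fin (M - m)) (Fin m ⊕ Fin (M - m)) ℝ,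
      (reindex (blockEquiv h) (blockEquiv h) A).trace = A.trace := fun A =>
    Equiv.sum_comp (blockEquiv h).symm fun i => A i i
  have hY : Y = reindex (blockEquiv h) (blockEquiv h)
      (fromBlocks (Y.submatrix (blockEquiv h) (blockEquiv h)).toBlocks₁₁
        (Y.submatrix (blockEquiv h) (blockEquiv h)).toBlocks₁₂
        (Y.submatrix (blockEquiv h) (blockEquiv h)).toBlocks₂₁
        (Y.submatrix (blockEquiv h) (blockEquiv h)).toBlocks₂₂) := by
    rw [fromBlocks_toBlocks]
    simp
  have hb : (Y.submatrix (blockEquiv h) (blockEquiv h)).toBlocks₁₁ =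
      Y.submatrix (Fin.castLE h) (Fin.castLE h) := by
    have hl : ∀ z : Fin m, blockEquiv h (Sum.inl z) = Fin.castLE h z := fun z =>
      Fin.ext (blockEquiv_inl_val h z)
    ext i j
    simp [toBlocks₁₁, hl]
  rw [Q, Q, padZero]
  conv_lhs => rw [hY, hb]
  rw [reindex_apply, reindex_apply, submatrix_mul_equiv, fromBlocks_multiply, ← reindex_apply, htr]
  simp [trace]

theorem Q_padZero (h : m ≤ M) (X Y : Matrix (Fin m) (Fin m) ℝ) :
    Q (padZero h X) (padZero h Y) = Q X Y := by
  rw [Q_padZero_right]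
  congr 1
  ext i j
  exact padZero_castLE h X i j

theorem SO.incl_mulVec_single (h : m ≤ M) (A : SO m) {i : Fin M} (hi : m ≤ i.val) :
    (SO.incl h A).1 *ᵥ Pi.single i 1 = Pi.single i 1 := by
  ext j
  simp only [mulVec_single_one, col_apply, SO.incl_apply, Pi.single_apply]
  rw [dif_neg (by omega)]

/-- The stabilizer of the last basis vector is the smaller special orthogonal group. -/
theorem SO.exists_incl_eq (h : m ≤ M) (hM : M = m + 1) {i : Fin M} (hi : i.val = m) {A : SO M}
    (hA : A.1 *ᵥ Pi.single i 1 = Pi.single i 1) : ∃ B : SO m, SO.incl h B = A := by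
  -- The transpose is the inverse and fixes the vector too, so the last row is trivial along with
  -- the last column.
  have hA' : (A.1)ᵀ *ᵥ Pi.single i 1 = Pi.single i 1 := by
    conv_lhs => rw [← hA, mulVec_mulVec, SO.transpose_mul, one_mulVec]
  have hcol : ∀ j, A.1 j i = if j = i then 1 else 0 := by
    intro j
    have := congrFun hA j
    simpa [Pi.single_apply] using this
  have hrow : ∀ j, A.1 i j = if j = i then 1 else 0 := by
    intro j
    have := congrFun hA' j
    simpa [Pi.single_apply] using this
  set C := A.1.submatrix (Fin.castLE h) (Fin.castLE h) with hC
  have hrep : A.1 = reindex (blockEquiv h) (blockEquiv h) (fromBlocks C 0 0 1) := by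
    ext j k
    obtain ⟨x, rfl⟩ := (blockEquiv h).surjective j
    obtain ⟨y, rfl⟩ := (blockEquiv h).surjective k
    have hr : ∀ z : Fin (M - m), blockEquiv h (Sum.inr z) = i := by
      intro z
      apply Fin.ext
      rw [blockEquiv_inr_val, hi]
      omega
    have hl : ∀ z : Fin m, blockEquiv h (Sum.inl z) = Fin.castLE h z := by
      intro z
      apply Fin.ext
      rw [blockEquiv_inl_val]
      rfl
    have hne : ∀ z : Fin m, Fin.castLE h z ≠ i := by
      intro z hz
      have := congrArg Fin.val hz
      simp at this
      omega
    simp only [reindex_apply, submatrix_apply, Equiv.symm_apply_apply]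
    rcases x with x | x <;> rcases y with y | y
    · simp [hl, hC]
    · simp [hl, hr, hcol, hne]
    · simp [hl, hr, hrow, hne]
    · have : x = y := by apply Fin.ext; omega
      subst this
      simp [hr, hcol]
  have hmem := SO.mem_iff.1 A.2
  rw [hrep, transpose_reindex, reindex_apply, reindex_apply, submatrix_mul_equiv,
    fromBlocks_transpose, fromBlocks_multiply] at hmem
  have hdet : C.det = 1 := by
    have := hmem.2
    rw [← reindex_apply, det_reindex_self, det_fromBlocks_zero₂₁] at this
    simpa using this
  have hmul : C * Cᵀ = 1 := by
    have h1 := hmem.1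
    rw [← submatrix_one_equiv (blockEquiv h).symm] at h1
    have h2 := congrArg (reindex (blockEquiv h).symm (blockEquiv h).symm) h1
    simp only [reindex_apply, Equiv.symm_symm, submatrix_submatrix, Equiv.symm_comp_self,
      submatrix_id_id] at h2
    rw [← fromBlocks_one, fromBlocks_inj] at h2
    simpa using h2.1
  exact ⟨⟨C, SO.mem_iff.2 ⟨hmul, hdet⟩⟩, Subtype.ext hrep.symm⟩

end Blocks

/-! ### The standard complex structure in coordinates -/

section StandardComplexStructure

variable {k n : ℕ}

/-- The index of the basis vector that is a multiple of `i` times the given one. -/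
def pairIndex (a : Fin (2 * k)) : Fin (2 * k) :=
  if h : a.val % 2 = 0 then ⟨a + 1, by omega⟩ else ⟨a - 1, by omega⟩

/-- The sign of the nonzero entry in a row of the standard complex structure. -/
def pairSign (a : Fin (2 * k)) : ℝ := if a.val % 2 = 0 then -1 else 1

theorem pairIndex_val (a : Fin (2 * k)) :
    (pairIndex a).val = if a.val % 2 = 0 then a.val + 1 else a.val - 1 := by
  unfold pairIndex
  split_ifs <;> rfl

theorem pairIndex_pairIndex (a : Fin (2 * k)) : pairIndex (pairIndex a) = a := by
  apply Fin.ext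
  simp only [pairIndex_val]
  split_ifs <;> omega

theorem pairSign_pairIndex (a : Fin (2 * k)) : pairSign (pairIndex a) = -pairSign a := by
  simp only [pairSign, pairIndex_val]
  split_ifs <;> first | omega | simp

theorem pairSign_mul_self (a : Fin (2 * k)) : pairSign a * pairSign a = 1 := by
  simp only [pairSign]
  split_ifs <;> norm_num

theorem complexStructure_apply (a b : Fin (2 * k)) :
    complexStructure k a b = if b = pairIndex a then pairSign a else 0 := by
  simp only [complexStructure, of_apply, Fin.ext_iff, pairIndex_val, pairSign]
  split_ifs <;> first | rfl | omega

theorem complexStructure_mul_apply {l : ℕ} (X : Matrix (Fin (2 * k)) (Fin l) ℝ) (a : Fin (2 * k))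
    (j : Fin l) : (complexStructure k * X) a j = pairSign a * X (pairIndex a) j := by
  simp [Matrix.mul_apply, complexStructure_apply]

theorem complexStructure_mulVec (x : Fin (2 * k) → ℝ) (a : Fin (2 * k)) :
    (complexStructure k *ᵥ x) a = pairSign a * x (pairIndex a) := by
  simp [mulVec, dotProduct, complexStructure_apply]

theorem mul_complexStructure_apply {l : ℕ} (X : Matrix (Fin l) (Fin (2 * k)) ℝ) (i : Fin l)
    (b : Fin (2 * k)) : (X * complexStructure k) i b = -(pairSign b * X i (pairIndex b)) := by
  have : ∀ a, (b = pairIndex a) ↔ (pairIndex b = a) := fun a =>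
    ⟨fun h => by rw [h, pairIndex_pairIndex], fun h => by rw [← h, pairIndex_pairIndex]⟩
  simp only [Matrix.mul_apply, complexStructure_apply, this, mul_ite, mul_zero,
    Finset.sum_ite_eq, Finset.mem_univ, if_true, pairSign_pairIndex]
  ring

theorem isComplexStructure_complexStructure (k : ℕ) :
    IsComplexStructure (complexStructure k) := by
  refine ⟨?_, ?_⟩
  · ext a b
    simp only [transpose_apply, Matrix.neg_apply, complexStructure, of_apply]
    split_ifs <;> first | omega | simp
  · ext a b
    rw [complexStructure_mul_apply, complexStructure_apply, pairIndex_pairIndex,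
      pairSign_pairIndex, Matrix.neg_apply, Matrix.one_apply]
    by_cases h : a = b
    · rw [if_pos h.symm, if_pos h, mul_neg, pairSign_mul_self]
    · rw [if_neg (Ne.symm h), if_neg h]
      simp

/-- A block of even size never separates the two indices of a pair, so the complex structures are
compatible with the block inclusions. -/
theorem pairIndex_lt_iff (k : ℕ) (a : Fin (2 * n)) :
    (pairIndex a).val < 2 * k ↔ a.val < 2 * k := by
  rw [pairIndex_val]
  split_ifs <;> omega

theorem pairIndex_castLE (h : 2 * k ≤ 2 * n) (a : Fin (2 * k)) :
    pairIndex (Fin.castLE h a) = Fin.castLE h (pairIndex a) := by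
  apply Fin.ext
  simp [pairIndex_val]

theorem pairSign_castLE (h : 2 * k ≤ 2 * n) (a : Fin (2 * k)) :
    pairSign (Fin.castLE h a) = pairSign a := rfl

theorem SO.incl_commute_iff (h : 2 * k ≤ 2 * n) (A : SO (2 * k)) :
    (SO.incl h A).1 * complexStructure n = complexStructure n * (SO.incl h A).1 ↔
      A.1 * complexStructure k = complexStructure k * A.1 := by
  constructor
  · intro hc
    ext i j
    have := congrFun (congrFun hc (Fin.castLE h i)) (Fin.castLE h j)
    simpa only [complexStructure_mul_apply, mul_complexStructure_apply, pairIndex_castLE,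
      pairSign_castLE, SO.incl_castLE] using this
  · intro hc
    ext i j
    by_cases hlt : i.val < 2 * k ∧ j.val < 2 * k
    · obtain ⟨i, rfl⟩ : ∃ i', i = Fin.castLE h i' := ⟨⟨i, hlt.1⟩, rfl⟩
      obtain ⟨j, rfl⟩ : ∃ j', j = Fin.castLE h j' := ⟨⟨j, hlt.2⟩, rfl⟩
      have := congrFun (congrFun hc i) j
      simpa only [complexStructure_mul_apply, mul_complexStructure_apply, pairIndex_castLE,
        pairSign_castLE, SO.incl_castLE] using this
    · rw [complexStructure_mul_apply, mul_complexStructure_apply, SO.incl_apply, SO.incl_apply,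
        dif_neg (by rw [pairIndex_lt_iff]; exact hlt),
        dif_neg (by rw [pairIndex_lt_iff]; exact hlt)]
      by_cases hij : i = pairIndex j
      · subst hij
        simp [pairIndex_pairIndex, pairSign_pairIndex]
      · have : pairIndex i ≠ j := fun h => hij (by rw [← h, pairIndex_pairIndex])
        simp [hij, this]

theorem padZero_isAntiSkew (h : 2 * k ≤ 2 * n) {X : Matrix (Fin (2 * k)) (Fin (2 * k)) ℝ}
    (hX : IsAntiSkew (complexStructure k) X) :
    IsAntiSkew (complexStructure n) (padZero h X) := by
  refine ⟨padZero_transpose h hX.transpose_eq, ?_⟩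
  ext i j
  by_cases hlt : i.val < 2 * k ∧ j.val < 2 * k
  · obtain ⟨i, rfl⟩ : ∃ i', i = Fin.castLE h i' := ⟨⟨i, hlt.1⟩, rfl⟩
    obtain ⟨j, rfl⟩ : ∃ j', j = Fin.castLE h j' := ⟨⟨j, hlt.2⟩, rfl⟩
    have := congrFun (congrFun hX.anticomm i) j
    simpa only [Matrix.neg_apply, complexStructure_mul_apply, mul_complexStructure_apply,
      pairIndex_castLE, pairSign_castLE, padZero_castLE] using this
  · rw [Matrix.neg_apply, complexStructure_mul_apply, mul_complexStructure_apply, padZero_apply,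
      padZero_apply, dif_neg (by rw [pairIndex_lt_iff]; exact hlt),
      dif_neg (by rw [pairIndex_lt_iff]; exact hlt)]
    simp

end StandardComplexStructure

/-! ### The isotropy summands -/

section Isotropy

variable {m n : ℕ}

theorem Q_comm (X Y : Matrix (Fin m) (Fin m) ℝ) : Q X Y = Q Y X := by
  rw [Q, Q, trace_mul_comm]

theorem Q_add_left (X X' Y : Matrix (Fin m) (Fin m) ℝ) : Q (X + X') Y = Q X Y + Q X' Y := by
  rw [Q, Q, Q, add_mul, trace_add]
  ring

theorem Q_sub_left (X X' Y : Matrix (Fin m) (Fin m) ℝ) : Q (X - X') Y = Q X Y - Q X' Y := by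
  rw [Q, Q, Q, sub_mul, trace_sub]
  ring

theorem Q_smul_left (c : ℝ) (X Y : Matrix (Fin m) (Fin m) ℝ) : Q (c • X) Y = c * Q X Y := by
  rw [Q, Q, smul_mul_assoc, trace_smul, smul_eq_mul]
  ring

theorem Q_add_right (X Y Y' : Matrix (Fin m) (Fin m) ℝ) : Q X (Y + Y') = Q X Y + Q X Y' := by
  rw [Q_comm, Q_add_left, Q_comm Y, Q_comm Y']

theorem Q_smul_right (c : ℝ) (X Y : Matrix (Fin m) (Fin m) ℝ) : Q X (c • Y) = c * Q X Y := by
  rw [Q_comm, Q_smul_left, Q_comm]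

theorem Q_conj (J X Y : Matrix (Fin m) (Fin m) ℝ) : Q (J * X * J) Y = Q X (J * Y * J) := by
  rw [Q, Q, mul_assoc, mul_assoc, trace_mul_comm]
  simp only [mul_assoc]

theorem eq_zero_of_Q_self {X : Matrix (Fin m) (Fin m) ℝ} (hX : Xᵀ = -X) (h : Q X X = 0) :
    X = 0 := by
  have h1 : (Xᴴ * X).trace = 0 := by
    rw [conjTranspose_eq_transpose_of_trivial, hX, neg_mul, trace_neg]
    rw [Q] at h
    linarith
  exact trace_conjTranspose_mul_self_eq_zero_iff.1 h1

/-- `W = X - JXJ` is twice the `u(k)`-component of `X`, and `Q(W, W) = 2 Q(X, W) = 0` because `JWJ =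
-W`. Hence `X = JXJ`, which is anticommutation. -/
theorem isAntiSkew_of_orthogonal {k : ℕ} {X : Matrix (Fin (2 * k)) (Fin (2 * k)) ℝ}
    (hX : X ∈ so (2 * k)) (h : ∀ W ∈ unitaryAlgebra k, Q X W = 0) :
    IsAntiSkew (complexStructure k) X := by
  have hJ := isComplexStructure_complexStructure k
  set J := complexStructure k
  have hXt : Xᵀ = -X := hX
  set W := X - J * X * J with hW
  have hWt : Wᵀ = -W := by
    rw [hW, transpose_sub, hJ.transpose_conj hXt, hXt]
    abel
  have hWJ : W * J = J * W := hJ.commute_part X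
  have h0 : Q X W = 0 := h W ⟨hWt, hWJ⟩
  have h1 : Q W W = 0 := by
    have h2 : J * W * J = -W := by rw [← hWJ, mul_assoc, hJ.mul_self, mul_neg, mul_one]
    have h3 : Q X (-W) = -Q X W := by
      rw [← neg_one_smul ℝ W, Q_smul_right, neg_one_mul]
    rw [hW, Q_sub_left, ← hW, Q_conj, h2, h3, h0]
    simp
  have h2 : X = J * X * J := sub_eq_zero.1 (eq_zero_of_Q_self hWt h1)
  refine ⟨hXt, ?_⟩
  conv_lhs => rw [h2]
  rw [mul_assoc, hJ.mul_self, mul_neg, mul_one]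

theorem padZero_isAntiSkew_of_mem_p₁ {X : Matrix (Fin (2 * n - 1)) (Fin (2 * n - 1)) ℝ}
    (hX : X ∈ p₁ n) :
    IsAntiSkew (complexStructure n) (padZero (two_mul_sub_one_le n) X) := by
  obtain ⟨X, hX, hX', rfl⟩ := hX
  rw [padZero_padZero]
  exact padZero_isAntiSkew _ (isAntiSkew_of_orthogonal hX hX')

theorem Q_eq_zero_of_mem {X Y : Matrix (Fin (2 * n - 1)) (Fin (2 * n - 1)) ℝ}
    (hX : X ∈ p₁ n) (hY : Y ∈ p₂ n) : Q X Y = 0 := by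
  obtain ⟨X, hX, -, rfl⟩ := hX
  rw [Q_comm]
  exact hY.2 X hX

/-- The upper left block of `Y` is itself an admissible test matrix, so it is `Q`-orthogonal to
itself. -/
theorem apply_eq_zero_of_mem_p₂ {Y : Matrix (Fin (2 * n - 1)) (Fin (2 * n - 1)) ℝ}
    (hY : Y ∈ p₂ n) (i j : Fin (2 * (n - 1))) :
    Y (Fin.castLE (two_mul_pred_le n) i) (Fin.castLE (two_mul_pred_le n) j) = 0 := by
  have hYt : Yᵀ = -Y := hY.1
  set W := Y.submatrix (Fin.castLE (two_mul_pred_le n)) (Fin.castLE (two_mul_pred_le n)) with hW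
  have hWt : Wᵀ = -W := by
    rw [hW, transpose_submatrix, hYt]
    rfl
  have h := hY.2 W hWt
  rw [Q_padZero_right] at h
  exact congrFun (congrFun (eq_zero_of_Q_self hWt h) i) j

theorem padZero_apply_of_mem_p₂ {Y : Matrix (Fin (2 * n - 1)) (Fin (2 * n - 1)) ℝ}
    (hY : Y ∈ p₂ n) (i j : Fin (2 * n))
    (h : i.val = 2 * n - 1 ∨ j.val = 2 * n - 1 ∨ i.val < 2 * (n - 1) ∧ j.val < 2 * (n - 1)) :
    padZero (two_mul_sub_one_le n) Y i j = 0 := by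
  rw [padZero_apply]
  split_ifs with hij
  · have h' : i.val < 2 * (n - 1) ∧ j.val < 2 * (n - 1) := by omega
    exact apply_eq_zero_of_mem_p₂ hY ⟨i, h'.1⟩ ⟨j, h'.2⟩
  · rfl

/-- A nonzero entry of `Y` has an index equal to `2n-2`, counted from `0`. Conjugation by `J` moves
this index to `2n-1`, where the padded matrices vanish. This disjointness of supports is the source
of the factor `1/2`. -/
theorem Q_padZero_conj_of_mem_p₂ {Y Y' : Matrix (Fin (2 * n - 1)) (Fin (2 * n - 1)) ℝ}
    (hY : Y ∈ p₂ n) (hY' : Y' ∈ p₂ n) :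
    Q (padZero (two_mul_sub_one_le n) Y)
      (complexStructure n * padZero (two_mul_sub_one_le n) Y' * complexStructure n) = 0 := by
  rw [Q, trace]
  simp only [diag_apply, Matrix.mul_apply (M := padZero _ Y), mul_assoc,
    complexStructure_mul_apply, mul_complexStructure_apply]
  rw [Finset.sum_eq_zero, mul_zero]
  intro i _
  refine Finset.sum_eq_zero fun j _ => ?_
  by_cases h : i.val = 2 * n - 1 ∨ j.val = 2 * n - 1 ∨ i.val < 2 * (n - 1) ∧ j.val < 2 * (n - 1)
  · rw [padZero_apply_of_mem_p₂ hY i j h, zero_mul]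
  · rw [padZero_apply_of_mem_p₂ hY' (pairIndex j) (pairIndex i)]
    · simp
    · rw [pairIndex_val, pairIndex_val]
      split_ifs <;> omega

/-- The form `Q` on the projections of `𝔭₁ ⊕ 𝔭₂` to the matrices anticommuting with `J`. -/
theorem Q_antiPart {X X' Y Y' : Matrix (Fin (2 * n - 1)) (Fin (2 * n - 1)) ℝ}
    (hX : X ∈ p₁ n) (hX' : X' ∈ p₁ n) (hY : Y ∈ p₂ n) (hY' : Y' ∈ p₂ n)
    {Z Z' : Matrix (Fin (2 * n)) (Fin (2 * n)) ℝ}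
    (hZ : Z = padZero (two_mul_sub_one_le n) (X + Y))
    (hZ' : Z' = padZero (two_mul_sub_one_le n) (X' + Y')) :
    Q ((1 / 2 : ℝ) • (Z + complexStructure n * Z * complexStructure n))
      ((1 / 2 : ℝ) • (Z' + complexStructure n * Z' * complexStructure n)) =
      Q X X' + 1 / 2 * Q Y Y' := by
  have hJ := isComplexStructure_complexStructure n
  have hb := Q_padZero_conj_of_mem_p₂ hY hY'
  -- The projection `Z ↦ ½(Z + JZJ)` is therefore the identity on `𝔭₁`.
  have hfix : ∀ {V}, V ∈ p₁ n → complexStructure n * padZero (two_mul_sub_one_le n) V *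
      complexStructure n = padZero (two_mul_sub_one_le n) V := by
    intro V hV
    rw [mul_assoc, (padZero_isAntiSkew_of_mem_p₁ hV).anticomm, mul_neg, ← mul_assoc, hJ.mul_self,
      neg_mul, one_mul, neg_neg]
  have h1 : Q (padZero (two_mul_sub_one_le n) X) (complexStructure n *
      padZero (two_mul_sub_one_le n) Y' * complexStructure n) = 0 := by
    rw [← Q_conj, hfix hX, Q_padZero, Q_eq_zero_of_mem hX hY']
  have h2 : Q (complexStructure n * padZero (two_mul_sub_one_le n) Y * complexStructure n)
      (padZero (two_mul_sub_one_le n) X') = 0 := by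
    rw [Q_conj, hfix hX', Q_padZero, Q_comm, Q_eq_zero_of_mem hX' hY]
  -- Conjugation by `J` preserves `Q`. With vanishing cross terms, the projection on `𝔭₂` yields
  -- `¼(1 + 1) Q(Y, Y')`.
  have h3 : Q (complexStructure n * padZero (two_mul_sub_one_le n) Y * complexStructure n)
      (complexStructure n * padZero (two_mul_sub_one_le n) Y' * complexStructure n) = Q Y Y' := by
    rw [Q_conj, ← mul_assoc, ← mul_assoc, hJ.mul_self, mul_assoc _ (complexStructure n), hJ.mul_self]
    simp [Q_padZero]
  rw [hZ, hZ', padZero_add, padZero_add]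
  simp only [mul_add, add_mul, hfix hX, hfix hX', Q_smul_left, Q_smul_right, Q_add_left,
    Q_add_right, h1, h2, h3, hb, Q_conj _ _ (padZero (two_mul_sub_one_le n) Y'), Q_padZero,
    Q_eq_zero_of_mem hX hY', Q_comm Y X', Q_eq_zero_of_mem hX' hY]
  ring

end Isotropy

/-! ### Compactness and connectedness of the groups -/

section GroupTopology

variable {m M n : ℕ}

theorem SO.mulVec_eq_iff_transpose {A : SO m} {x y : Fin m → ℝ} :
    A.1 *ᵥ x = y ↔ x = (A.1)ᵀ *ᵥ y := by
  constructor
  · rintro rfl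
    rw [mulVec_mulVec, SO.transpose_mul, one_mulVec]
  · rintro rfl
    rw [mulVec_mulVec, SO.mul_transpose, one_mulVec]

instance : CompactSpace (SO m) := by
  have hset : ((Matrix.specialOrthogonalGroup (Fin m) ℝ : Set (Matrix (Fin m) (Fin m) ℝ))) =
      {A | A * Aᵀ = 1} ∩ {A | A.det = 1} := by
    ext A
    exact SO.mem_iff
  have hclosed : IsClosed
      ((Matrix.specialOrthogonalGroup (Fin m) ℝ : Set (Matrix (Fin m) (Fin m) ℝ))) := by
    rw [hset]
    refine IsClosed.inter (isClosed_eq ?_ continuous_const) (isClosed_eq ?_ continuous_const)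
    · exact continuous_id.matrix_mul continuous_id.matrix_transpose
    · exact continuous_id.matrix_det
  have hcomp : IsCompact (Set.pi Set.univ fun _ : Fin m => Set.pi Set.univ fun _ : Fin m =>
      Set.Icc (-1 : ℝ) 1) :=
    isCompact_univ_pi fun _ => isCompact_univ_pi fun _ => isCompact_Icc
  have hsub : ((Matrix.specialOrthogonalGroup (Fin m) ℝ : Set (Matrix (Fin m) (Fin m) ℝ))) ⊆
      (Set.pi Set.univ fun _ : Fin m => Set.pi Set.univ fun _ : Fin m => Set.Icc (-1 : ℝ) 1) := by
    intro A hA i _ j _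
    have h1 := congrFun (congrFun (SO.mem_iff.1 hA).1 i) i
    rw [Matrix.mul_apply, Matrix.one_apply_eq] at h1
    simp only [transpose_apply] at h1
    have h2 : A i j * A i j ≤ 1 := by
      rw [← h1]
      exact Finset.single_le_sum (f := fun k => A i k * A i k)
        (fun k _ => mul_self_nonneg (A i k)) (Finset.mem_univ j)
    exact abs_le.1 (abs_le_one_iff_mul_self_le_one.2 h2)
  exact isCompact_iff_compactSpace.1 (hcomp.of_isClosed_subset hclosed hsub)

theorem SO.continuous_incl (h : m ≤ M) : Continuous (SO.incl h) := by
  refine Continuous.subtype_mk (continuous_matrix fun i j => ?_) _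
  change Continuous fun A : SO m => (SO.incl h A).1 i j
  simp only [SO.incl_apply]
  split_ifs
  · exact continuous_subtype_val.matrix_elem _ _
  · exact continuous_const
  · exact continuous_const

/-- A compact space with a continuous surjection with connected fibres onto a connected Hausdorff
space is connected. -/
theorem connectedSpace_of_fibres {X Y : Type*} [TopologicalSpace X] [TopologicalSpace Y]
    [CompactSpace X] [T2Space Y] [ConnectedSpace Y] {f : X → Y} (hf : Continuous f)
    (hfib : ∀ y, IsConnected (f ⁻¹' {y})) : ConnectedSpace X := by
  have hs : Function.Surjective f := fun y => (hfib y).nonempty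
  -- A continuous map from a compact space to a Hausdorff space is closed, hence a quotient map when
  -- surjective.
  have hq := hf.isClosedMap.isQuotientMap hf hs
  have h := hq.isCoinducing.isConnected_preimage_of_isClosed hfib isClosed_univ isConnected_univ
  rw [Set.preimage_univ] at h
  exact connectedSpace_iff_univ.2 h

/-- The unit sphere in `ℝ^m`. -/
abbrev UnitSphere (m : ℕ) : Type := Metric.sphere (0 : EuclideanSpace ℝ (Fin m)) 1

theorem mem_unitSphere_iff {x : Fin m → ℝ} :
    WithLp.toLp 2 x ∈ Metric.sphere (0 : EuclideanSpace ℝ (Fin m)) 1 ↔ x ⬝ᵥ x = 1 := by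
  rw [mem_sphere_zero_iff_norm, EuclideanSpace.norm_eq, Real.sqrt_eq_one]
  simp [dotProduct, sq]

theorem connectedSpace_unitSphere (hm : 2 ≤ m) : ConnectedSpace (UnitSphere m) := by
  refine isConnected_iff_connectedSpace.1 (isConnected_sphere ?_ 0 zero_le_one)
  rw [rank_eq_card_basis (EuclideanSpace.basisFun (Fin m) ℝ).toBasis]
  simp
  omega

/-- The orbit map of a basis vector. -/
def SO.column (i : Fin m) (A : SO m) : UnitSphere m :=
  ⟨WithLp.toLp 2 (A.1 *ᵥ Pi.single i 1), by
    rw [mem_unitSphere_iff, SO.mulVec_dotProduct_mulVec, single_dotProduct_self]⟩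

theorem SO.continuous_column (i : Fin m) : Continuous (SO.column i) := by
  refine Continuous.subtype_mk ?_ _
  refine (PiLp.continuous_toLp 2 _).comp ?_
  exact continuous_subtype_val.matrix_mulVec continuous_const

theorem SO.column_eq_iff {i : Fin m} {A : SO m} {y : UnitSphere m} :
    SO.column i A = y ↔ A.1 *ᵥ Pi.single i 1 = y.1.ofLp := by
  rw [Subtype.ext_iff]
  exact ⟨fun h => by rw [← h]; rfl, fun h => congrArg (WithLp.toLp 2) h⟩

theorem UnitSphere.dotProduct_self (y : UnitSphere m) : y.1.ofLp ⬝ᵥ y.1.ofLp = 1 :=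
  mem_unitSphere_iff.1 y.2

theorem SO.column_eq_column_iff {i : Fin m} {A B : SO m} :
    SO.column i A = SO.column i B ↔ (A⁻¹ * B).1 *ᵥ Pi.single i 1 = Pi.single i 1 := by
  rw [eq_comm, SO.column_eq_iff, Submonoid.coe_mul, ← mulVec_mulVec, SO.inv_coe]
  change _ = A.1 *ᵥ Pi.single i 1 ↔ _
  rw [← SO.inv_coe, SO.mulVec_eq_iff_transpose (A := A⁻¹), SO.inv_coe, transpose_transpose]

/-- Induction along `SO(m+1) → SO(m+2) → S^{m+1}`, whose fibres are cosets of the smaller group. The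
case `m = 1` is treated separately because `S^0` is disconnected. -/
theorem SO.connectedSpace : ∀ m : ℕ, ConnectedSpace (SO m)
  | 0 => by
    have : Subsingleton (SO 0) := ⟨fun A B => Subtype.ext (Subsingleton.elim _ _)⟩
    exact connectedSpace_iff_univ.2 ⟨⟨1, trivial⟩, Set.subsingleton_univ.isPreconnected⟩
  | 1 => by
    have : Subsingleton (SO 1) := ⟨fun A B => Subtype.ext (by
      ext i j
      have hA := (SO.mem_iff.1 A.2).2
      have hB := (SO.mem_iff.1 B.2).2
      rw [det_fin_one] at hA hB
      rw [Subsingleton.elim i 0, Subsingleton.elim j 0, hA, hB])⟩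
    exact connectedSpace_iff_univ.2 ⟨⟨1, trivial⟩, Set.subsingleton_univ.isPreconnected⟩
  | m + 2 => by
    have := SO.connectedSpace (m + 1)
    have := connectedSpace_unitSphere (m := m + 2) (by omega)
    have hle : m + 1 ≤ m + 2 := by omega
    refine connectedSpace_of_fibres (SO.continuous_column (Fin.last (m + 1))) fun y => ?_
    obtain ⟨A, hA⟩ := SO.exists_mulVec_eq (by omega)
      (single_dotProduct_self (Fin.last (m + 1))) y.dotProduct_self
    have hfib : SO.column (Fin.last (m + 1)) ⁻¹' {y} =
        (fun B => A * SO.incl hle B) '' Set.univ := by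
      ext C
      rw [Set.mem_preimage, Set.mem_singleton_iff, ← SO.column_eq_iff.2 hA, eq_comm,
        SO.column_eq_column_iff]
      constructor
      · intro hC
        obtain ⟨B, hB⟩ := SO.exists_incl_eq hle rfl (by simp) hC
        exact ⟨B, trivial, by simp only [hB, mul_inv_cancel_left]⟩
      · rintro ⟨B, -, rfl⟩
        simp only [inv_mul_cancel_left]
        exact SO.incl_mulVec_single hle B (by simp)
    rw [hfib]
    exact isConnected_univ.image _ (continuous_const.mul (SO.continuous_incl hle)).continuousOn

/-! ### Stabilizers in the unitary group and its connectedness -/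

theorem mem_unitaryInSO_iff {A : SO (2 * n)} :
    A ∈ unitaryInSO n ↔ A.1 * complexStructure n = complexStructure n * A.1 := Iff.rfl

theorem complexStructure_mulVec_single (i : Fin (2 * n)) :
    complexStructure n *ᵥ Pi.single i 1 = -pairSign i • Pi.single (pairIndex i) 1 := by
  ext a
  rw [complexStructure_mulVec]
  have : pairIndex a = i ↔ a = pairIndex i :=
    ⟨fun h => by rw [← h, pairIndex_pairIndex], fun h => by rw [h, pairIndex_pairIndex]⟩
  by_cases h : a = pairIndex i
  · subst h
    simp [pairIndex_pairIndex, pairSign_pairIndex]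
  · simp [this, h]

/-- The stabilizer of the last basis vector in `U(n)` is `U(n-1)`. -/
theorem exists_unitary_incl_eq (hn : 1 ≤ n) {i : Fin (2 * n)} (hi : i.val = 2 * n - 1)
    {U : SO (2 * n)} (hU : U ∈ unitaryInSO n) (h : U.1 *ᵥ Pi.single i 1 = Pi.single i 1) :
    ∃ D ∈ unitaryInSO (n - 1),
      SO.incl (two_mul_sub_one_le n) (SO.incl (two_mul_pred_le n) D) = U := by
  obtain ⟨C, rfl⟩ := SO.exists_incl_eq (two_mul_sub_one_le n) (by omega) hi h
  have hpair : pairIndex i = Fin.castLE (two_mul_sub_one_le n) ⟨2 * n - 2, by omega⟩ := by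
    apply Fin.ext
    rw [pairIndex_val, Fin.val_castLE, if_neg (by omega), hi]
    change 2 * n - 1 - 1 = 2 * n - 2
    omega
  -- A unitary map fixing `e_i` also fixes `Je_i`, a multiple of its partner. The stabilizer lemma
  -- thus applies a second time and descends from `2n-1` to `2n-2`.
  have h1 : (SO.incl (two_mul_sub_one_le n) C).1 *ᵥ Pi.single (pairIndex i) 1 =
      Pi.single (pairIndex i) 1 := by
    have h2 : (SO.incl (two_mul_sub_one_le n) C).1 *ᵥ (complexStructure n *ᵥ Pi.single i 1) =
        complexStructure n *ᵥ Pi.single i 1 := by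
      rw [mulVec_mulVec, mem_unitaryInSO_iff.1 hU, ← mulVec_mulVec, h]
    rw [complexStructure_mulVec_single, mulVec_smul] at h2
    have h3 : -pairSign i ≠ 0 := by
      intro h0
      have := pairSign_mul_self i
      rw [neg_eq_zero.1 h0] at this
      norm_num at this
    exact smul_right_injective _ h3 h2
  have hC : C.1 *ᵥ Pi.single ⟨2 * n - 2, by omega⟩ 1 = Pi.single ⟨2 * n - 2, by omega⟩ 1 := by
    ext j
    have := congrFun h1 (Fin.castLE (two_mul_sub_one_le n) j)
    rw [hpair] at this
    simpa only [mulVec_single_one, col_apply, SO.incl_castLE, Pi.single_apply,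
      (Fin.castLE_injective _).eq_iff] using this
  obtain ⟨D, rfl⟩ := SO.exists_incl_eq (two_mul_pred_le n) (by omega) (by simp; omega) hC
  refine ⟨D, ?_, rfl⟩
  rw [mem_unitaryInSO_iff, SO.incl_incl, SO.incl_commute_iff] at hU
  exact hU

instance : CompactSpace (unitaryInSO n) := by
  refine isCompact_iff_compactSpace.1 (IsClosed.isCompact (isClosed_eq ?_ ?_))
  · exact continuous_subtype_val.matrix_mul continuous_const
  · exact continuous_const.matrix_mul continuous_subtype_val

/-- The same induction along `U(k) → U(k+1) → S^{2k+1}`; all these spheres are connected, so `0` is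
the only base case. -/
theorem connectedSpace_unitaryInSO : ∀ n : ℕ, ConnectedSpace (unitaryInSO n)
  | 0 => by
    have : Subsingleton (unitaryInSO 0) :=
      ⟨fun A B => Subtype.ext (Subtype.ext (Matrix.ext fun i => i.elim0))⟩
    exact connectedSpace_iff_univ.2 ⟨⟨1, trivial⟩, Set.subsingleton_univ.isPreconnected⟩
  | k + 1 => by
    have := connectedSpace_unitaryInSO k
    have := connectedSpace_unitSphere (m := 2 * (k + 1)) (by omega)
    have hJ := isComplexStructure_complexStructure (k + 1)
    set i : Fin (2 * (k + 1)) := ⟨2 * (k + 1) - 1, by omega⟩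
    have hle : 2 * k ≤ 2 * (k + 1) := by omega
    refine connectedSpace_of_fibres ((SO.continuous_column i).comp continuous_subtype_val)
      fun y => ?_
    obtain ⟨A, hAJ, hA⟩ := hJ.exists_mulVec_eq
      ((single_dotProduct_self i).trans y.dotProduct_self.symm)
    have hcont : Continuous fun D : unitaryInSO k => (⟨A * SO.incl hle D.1,
        mul_mem hAJ ((SO.incl_commute_iff hle D.1).2 D.2)⟩ : unitaryInSO (k + 1)) :=
      (continuous_const.mul ((SO.continuous_incl hle).comp continuous_subtype_val)).subtype_mk _
    have hfib : (SO.column i ∘ Subtype.val) ⁻¹' {y} =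
        (fun D : unitaryInSO k => (⟨A * SO.incl hle D.1,
          mul_mem hAJ ((SO.incl_commute_iff hle D.1).2 D.2)⟩ : unitaryInSO (k + 1))) ''
            Set.univ := by
      ext C
      rw [Set.mem_preimage, Set.mem_singleton_iff, ← SO.column_eq_iff.2 hA, eq_comm,
        Function.comp_apply, SO.column_eq_column_iff]
      constructor
      · intro hC
        obtain ⟨D, hD, hB⟩ := exists_unitary_incl_eq (by omega) rfl
          (mul_mem (inv_mem (show A ∈ unitaryInSO (k + 1) from hAJ)) C.2) hC
        refine ⟨⟨D, hD⟩, trivial, Subtype.ext ?_⟩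
        rw [SO.incl_incl] at hB
        exact (congrArg (A * ·) hB).trans (mul_inv_cancel_left A C.1)
      · rintro ⟨B, -, rfl⟩
        simp only [inv_mul_cancel_left]
        exact SO.incl_mulVec_single hle B.1 (by simp [i]; omega)
    rw [hfib]
    exact isConnected_univ.image _ hcont.continuousOn

end GroupTopology

/-! ### The homogeneous spaces -/

section HomogeneousSpaces

variable (n : ℕ)

/-- The map `A U(n) ↦ A J A⁻¹` identifies `SO(2n)/U(n)` with a set of complex structures. -/
def complexStructureOfCoset : SO (2 * n) ⧸ unitaryInSO n → Matrix (Fin (2 * n)) (Fin (2 * n)) ℝ :=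
  Quotient.lift (fun A : SO (2 * n) => A.1 * complexStructure n * (A.1)ᵀ) (by
    intro A B h
    have h1 : (A⁻¹ * B).1 * complexStructure n = complexStructure n * (A⁻¹ * B).1 :=
      QuotientGroup.leftRel_apply.1 h
    obtain ⟨U, rfl⟩ : ∃ U, B = A * U := ⟨A⁻¹ * B, by rw [mul_inv_cancel_left]⟩
    rw [inv_mul_cancel_left] at h1
    change _ = (A.1 * U.1) * complexStructure n * (A.1 * U.1)ᵀ
    have h2 : A.1 * U.1 * complexStructure n * (A.1 * U.1)ᵀ =
        A.1 * (U.1 * complexStructure n) * (U.1)ᵀ * (A.1)ᵀ := by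
      simp only [transpose_mul, mul_assoc]
    rw [h2, h1, ← mul_assoc A.1, mul_assoc _ U.1, SO.mul_transpose, mul_one])

theorem complexStructureOfCoset_mk (A : SO (2 * n)) :
    complexStructureOfCoset n (QuotientGroup.mk A) = A.1 * complexStructure n * (A.1)ᵀ := rfl

/-- `U(n)` is exactly the stabilizer of `J` under conjugation. The quotient thus injects
continuously into a matrix space and is Hausdorff. -/
theorem complexStructureOfCoset_injective : Function.Injective (complexStructureOfCoset n) := by
  intro a b
  induction a using QuotientGroup.induction_on with | H A => ?_
  induction b using QuotientGroup.induction_on with | H B => ?_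
  intro h
  rw [complexStructureOfCoset_mk, complexStructureOfCoset_mk] at h
  rw [QuotientGroup.eq, mem_unitaryInSO_iff, Submonoid.coe_mul, SO.inv_coe]
  calc (A.1)ᵀ * B.1 * complexStructure n
      = (A.1)ᵀ * (B.1 * complexStructure n * (B.1)ᵀ) * B.1 := by
        simp only [mul_assoc, SO.transpose_mul, mul_one]
    _ = complexStructure n * ((A.1)ᵀ * B.1) := by
        rw [← h]
        simp only [← mul_assoc, SO.transpose_mul, one_mul]

instance : T2Space (SO (2 * n) ⧸ unitaryInSO n) := by
  refine T2Space.of_injective_continuous (complexStructureOfCoset_injective n) ?_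
  refine Continuous.quotient_lift ?_ _
  exact (continuous_subtype_val.matrix_mul continuous_const).matrix_mul
    continuous_subtype_val.matrix_transpose

instance : CompactSpace (SO (2 * n - 1) ⧸ smallUnitaryInSO n) :=
  inferInstanceAs (CompactSpace (Quotient _))

instance : CompactSpace (SO (2 * n - 1) ⧸ evenInSO n) :=
  inferInstanceAs (CompactSpace (Quotient _))

theorem incl_mem_unitaryInSO_of_mem {C : SO (2 * n - 1)} (hC : C ∈ smallUnitaryInSO n) :
    SO.incl (two_mul_sub_one_le n) C ∈ unitaryInSO n := by
  obtain ⟨D, hD, rfl⟩ := hC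
  rw [SO.incl_incl]
  exact (SO.incl_commute_iff _ D).2 hD

/-- The map `SO(2n-1)/U(n-1) → SO(2n)/U(n)` induced by the inclusion. -/
def cosetMap : SO (2 * n - 1) ⧸ smallUnitaryInSO n → SO (2 * n) ⧸ unitaryInSO n :=
  Quotient.lift (fun B => QuotientGroup.mk (SO.incl (two_mul_sub_one_le n) B)) (by
    intro A B h
    rw [QuotientGroup.eq, ← map_inv, ← map_mul]
    exact incl_mem_unitaryInSO_of_mem n (QuotientGroup.leftRel_apply.1 h))

theorem cosetMap_mk (B : SO (2 * n - 1)) :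
    cosetMap n (QuotientGroup.mk B) = QuotientGroup.mk (SO.incl (two_mul_sub_one_le n) B) := rfl

theorem continuous_cosetMap : Continuous (cosetMap n) :=
  Continuous.quotient_lift (continuous_quot_mk.comp (SO.continuous_incl _)) _

theorem smallUnitaryInSO_le : smallUnitaryInSO n ≤ evenInSO n := by
  rintro _ ⟨D, -, rfl⟩
  exact ⟨D, rfl⟩

variable [n.AtLeastTwo]

/-- The last basis index of `ℝ^{2n}`. -/
def topIndex : Fin (2 * n) :=
  ⟨2 * n - 1, by have := Nat.AtLeastTwo.prop (n := n); omega⟩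

theorem SO.incl_mulVec_topIndex (B : SO (2 * n - 1)) :
    (SO.incl (two_mul_sub_one_le n) B).1 *ᵥ Pi.single (topIndex n) 1 =
      Pi.single (topIndex n) 1 :=
  SO.incl_mulVec_single _ _ (by simp [topIndex])

/-- Every coset of `U(n)` in `SO(2n)` meets `SO(2n-1)`. -/
theorem exists_incl_eq_mul_unitary (A : SO (2 * n)) :
    ∃ B : SO (2 * n - 1), ∃ U ∈ unitaryInSO n, SO.incl (two_mul_sub_one_le n) B = A * U := by
  have hn := Nat.AtLeastTwo.prop (n := n)
  have hJ := isComplexStructure_complexStructure n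
  -- By transitivity of `U(n)` on the sphere, `U e_{2n} = A⁻¹ e_{2n}` can be arranged, so that `AU`
  -- fixes `e_{2n}`.
  obtain ⟨U, hU, hUf⟩ := hJ.exists_mulVec_eq
    (u := Pi.single (topIndex n) 1) (v := (A⁻¹).1 *ᵥ Pi.single (topIndex n) 1)
    (SO.mulVec_dotProduct_mulVec _ _ _).symm
  have hAU : (A * U).1 *ᵥ Pi.single (topIndex n) 1 = Pi.single (topIndex n) 1 := by
    rw [Submonoid.coe_mul, ← mulVec_mulVec, hUf, SO.inv_coe, mulVec_mulVec, SO.mul_transpose,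
      one_mulVec]
  obtain ⟨B, hB⟩ := SO.exists_incl_eq (two_mul_sub_one_le n) (by omega) rfl hAU
  exact ⟨B, U, hU, hB⟩

/-- Injectivity is `U(n) ∩ SO(2n-1) = U(n-1)`; surjectivity is `SO(2n) = SO(2n-1) U(n)`. -/
theorem cosetMap_bijective : Function.Bijective (cosetMap n) := by
  have hn := Nat.AtLeastTwo.prop (n := n)
  constructor
  · intro a b
    induction a using QuotientGroup.induction_on with | H A => ?_
    induction b using QuotientGroup.induction_on with | H B => ?_
    intro h
    rw [cosetMap_mk, cosetMap_mk, QuotientGroup.eq, ← map_inv, ← map_mul] at h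
    obtain ⟨D, hD, h1⟩ := exists_unitary_incl_eq (by omega) (i := topIndex n) rfl h
      (SO.incl_mulVec_topIndex n _)
    exact QuotientGroup.eq.2 ⟨D, hD, SO.incl_injective _ h1⟩
  · intro a
    induction a using QuotientGroup.induction_on with | H A => ?_
    obtain ⟨B, U, hU, hB⟩ := exists_incl_eq_mul_unitary n A
    refine ⟨QuotientGroup.mk B, ?_⟩
    rw [cosetMap_mk, hB, QuotientGroup.eq, _root_.mul_inv_rev, inv_mul_cancel_right]
    exact inv_mem hU

/-- The homeomorphism `SO(2n-1)/U(n-1) ≃ SO(2n)/U(n)`. -/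
noncomputable def cosetHomeo :
    SO (2 * n - 1) ⧸ smallUnitaryInSO n ≃ₜ SO (2 * n) ⧸ unitaryInSO n :=
  Continuous.homeoOfEquivCompactToT2 (f := Equiv.ofBijective _ (cosetMap_bijective n))
    (continuous_cosetMap n)

theorem cosetHomeo_mk (B : SO (2 * n - 1)) :
    cosetHomeo n (QuotientGroup.mk B) =
      QuotientGroup.mk (SO.incl (two_mul_sub_one_le n) B) := rfl

theorem mem_evenInSO_iff {C : SO (2 * n - 1)} :
    C ∈ evenInSO n ↔ C.1 *ᵥ Pi.single (lastIndex n) 1 = Pi.single (lastIndex n) 1 := by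
  have hn := Nat.AtLeastTwo.prop (n := n)
  have hval : (lastIndex n).val = 2 * (n - 1) := by
    change 2 * n - 2 = _
    omega
  constructor
  · rintro ⟨D, rfl⟩
    exact SO.incl_mulVec_single _ _ hval.ge
  · intro h
    exact SO.exists_incl_eq (two_mul_pred_le n) (by omega) hval h

theorem column_eq_iff_mk_eq {B C : SO (2 * n - 1)} :
    SO.column (lastIndex n) B = SO.column (lastIndex n) C ↔
      (QuotientGroup.mk B : SO (2 * n - 1) ⧸ evenInSO n) = QuotientGroup.mk C := by
  rw [SO.column_eq_column_iff, QuotientGroup.eq, mem_evenInSO_iff]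

/-- The map `SO(2n-1)/SO(2n-2) → S^{2n-2}` given by the action on the last basis vector. -/
def sphereMap : SO (2 * n - 1) ⧸ evenInSO n → EvenSphere n :=
  Quotient.lift (SO.column (lastIndex n)) fun _ _ h =>
    (column_eq_iff_mk_eq n).2 (QuotientGroup.eq.2 (QuotientGroup.leftRel_apply.1 h))

theorem sphereMap_bijective : Function.Bijective (sphereMap n) := by
  have hn := Nat.AtLeastTwo.prop (n := n)
  constructor
  · intro a b
    induction a using QuotientGroup.induction_on with | H A => ?_
    induction b using QuotientGroup.induction_on with | H B => ?_
    exact (column_eq_iff_mk_eq n).1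
  · intro y
    obtain ⟨B, hB⟩ := SO.exists_mulVec_eq (by omega)
      (single_dotProduct_self (lastIndex n)) (UnitSphere.dotProduct_self y)
    exact ⟨QuotientGroup.mk B, SO.column_eq_iff.2 hB⟩

/-- The homeomorphism `SO(2n-1)/SO(2n-2) ≃ S^{2n-2}`. -/
noncomputable def sphereHomeo : SO (2 * n - 1) ⧸ evenInSO n ≃ₜ EvenSphere n :=
  Continuous.homeoOfEquivCompactToT2 (f := Equiv.ofBijective _ (sphereMap_bijective n))
    (Continuous.quotient_lift (SO.continuous_column _) _)

theorem sphereHomeo_mk (B : SO (2 * n - 1)) :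
    sphereHomeo n (QuotientGroup.mk B) = SO.column (lastIndex n) B := rfl

/-- The projection `SO(2n) → SO(2n)/U(n) = SO(2n-1)/U(n-1) → SO(2n-1)/SO(2n-2) = S^{2n-2}`. -/
noncomputable def sphereProj (A : SO (2 * n)) : EvenSphere n :=
  sphereHomeo n (Subgroup.quotientMapOfLE (smallUnitaryInSO_le n)
    ((cosetHomeo n).symm (QuotientGroup.mk A)))

variable {n}

theorem sphereProj_eq {A : SO (2 * n)} {B : SO (2 * n - 1)}
    (h : (QuotientGroup.mk A : SO (2 * n) ⧸ unitaryInSO n) =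
      QuotientGroup.mk (SO.incl (two_mul_sub_one_le n) B)) :
    sphereProj n A = SO.column (lastIndex n) B := by
  rw [sphereProj, h, ← cosetHomeo_mk, Homeomorph.symm_apply_apply]
  rfl

theorem pairIndex_topIndex :
    pairIndex (topIndex n) = Fin.castLE (two_mul_sub_one_le n) (lastIndex n) := by
  have hn := Nat.AtLeastTwo.prop (n := n)
  apply Fin.ext
  rw [pairIndex_val]
  change (if (2 * n - 1) % 2 = 0 then 2 * n - 1 + 1 else 2 * n - 1 - 1) = 2 * n - 2
  rw [if_neg (by omega)]
  omega

theorem pairSign_topIndex : pairSign (topIndex n) = 1 := by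
  have hn := Nat.AtLeastTwo.prop (n := n)
  rw [pairSign, if_neg]
  simp only [topIndex]
  omega

theorem complexStructure_mulVec_topIndex :
    complexStructure n *ᵥ Pi.single (topIndex n) 1 =
      -Pi.single (Fin.castLE (two_mul_sub_one_le n) (lastIndex n)) 1 := by
  rw [complexStructure_mulVec_single, pairIndex_topIndex, pairSign_topIndex, neg_one_smul]

/-- The projection to the sphere in coordinates. -/
theorem sphereProj_apply (A : SO (2 * n)) (i : Fin (2 * n - 1)) :
    (sphereProj n A).1 i = -((A.1 * complexStructure n * (A.1)ᵀ)
      (Fin.castLE (two_mul_sub_one_le n) i) (topIndex n)) := by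
  obtain ⟨B, U, hU, hB⟩ := exists_incl_eq_mul_unitary n A
  have hmk : (QuotientGroup.mk A : SO (2 * n) ⧸ unitaryInSO n) =
      QuotientGroup.mk (SO.incl (two_mul_sub_one_le n) B) := by
    rw [hB, QuotientGroup.eq, inv_mul_cancel_left]
    exact hU
  -- Both sides depend only on the coset of `A`, so `A` may be replaced by a representative from
  -- `SO(2n-1)`. It fixes `e_{2n}`, and `J e_{2n} = -e_{2n-1}` gives the sign.
  rw [sphereProj_eq hmk, ← complexStructureOfCoset_mk, hmk, complexStructureOfCoset_mk]
  set C := SO.incl (two_mul_sub_one_le n) B with hC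
  have h1 : (C.1)ᵀ *ᵥ Pi.single (topIndex n) 1 = Pi.single (topIndex n) 1 := by
    rw [← SO.mulVec_eq_iff_transpose.1 (SO.incl_mulVec_topIndex n B)]
  have h2 : (C.1 * complexStructure n * (C.1)ᵀ) *ᵥ Pi.single (topIndex n) 1 =
      -(C.1 *ᵥ Pi.single (Fin.castLE (two_mul_sub_one_le n) (lastIndex n)) 1) := by
    rw [← mulVec_mulVec, h1, ← mulVec_mulVec, complexStructure_mulVec_topIndex, mulVec_neg]
  have h3 := congrFun h2 (Fin.castLE (two_mul_sub_one_le n) i)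
  rw [mulVec_single_one, col_apply, Pi.neg_apply, mulVec_single_one, col_apply, hC,
    SO.incl_castLE] at h3
  rw [h3, neg_neg]
  change (B.1 *ᵥ Pi.single (lastIndex n) 1) i = _
  rw [mulVec_single_one, col_apply]

theorem sphereProj_surjective : Function.Surjective (sphereProj n) := by
  intro y
  obtain ⟨b, hb⟩ := (sphereHomeo n).surjective y
  induction b using QuotientGroup.induction_on with | H B => ?_
  exact ⟨SO.incl (two_mul_sub_one_le n) B, by rw [sphereProj_eq rfl, ← hb, sphereHomeo_mk]⟩

/-- The fibre over `B e_{2n-1}` is `B SO(2n-2) U(n)`, a continuous image of a product of connected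
groups. -/
theorem isConnected_sphereProj_preimage (y : EvenSphere n) :
    IsConnected (sphereProj n ⁻¹' {y}) := by
  have := SO.connectedSpace (2 * (n - 1))
  have := connectedSpace_unitaryInSO n
  obtain ⟨b, hb⟩ := (sphereHomeo n).surjective y
  induction b using QuotientGroup.induction_on with | H B => ?_
  rw [sphereHomeo_mk] at hb
  have hfib : sphereProj n ⁻¹' {y} =
      (fun p : SO (2 * (n - 1)) × unitaryInSO n => SO.incl (two_mul_sub_one_le n)
        (B * SO.incl (two_mul_pred_le n) p.1) * p.2.1) '' Set.univ := by
    ext A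
    rw [Set.mem_preimage, Set.mem_singleton_iff, ← hb]
    constructor
    · intro hA
      obtain ⟨C, U, hU, hC⟩ := exists_incl_eq_mul_unitary n A
      have hmk : (QuotientGroup.mk A : SO (2 * n) ⧸ unitaryInSO n) =
          QuotientGroup.mk (SO.incl (two_mul_sub_one_le n) C) := by
        rw [hC, QuotientGroup.eq, inv_mul_cancel_left]
        exact hU
      rw [sphereProj_eq hmk, eq_comm, column_eq_iff_mk_eq, QuotientGroup.eq] at hA
      obtain ⟨D, hD⟩ := hA
      refine ⟨(D, ⟨U⁻¹, inv_mem hU⟩), trivial, ?_⟩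
      simp only [hD, mul_inv_cancel_left, hC, mul_inv_cancel_right]
    · rintro ⟨⟨D, U⟩, -, rfl⟩
      rw [sphereProj_eq (B := B * SO.incl (two_mul_pred_le n) D), eq_comm, column_eq_iff_mk_eq,
        QuotientGroup.eq, inv_mul_cancel_left]
      · exact ⟨D, rfl⟩
      · rw [eq_comm, QuotientGroup.eq, inv_mul_cancel_left]
        exact U.2
  rw [hfib]
  refine isConnected_univ.image _ (Continuous.continuousOn ?_)
  exact ((SO.continuous_incl _).comp (continuous_const.mul
    ((SO.continuous_incl _).comp continuous_fst))).mul
      (continuous_subtype_val.comp continuous_snd)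

end HomogeneousSpaces

/-! ### Tangent vectors of the special orthogonal group as matrices -/

namespace SO

variable {m : ℕ}

theorem skew_add (x y : SkewCoord m) : skew (x + y) = skew x + skew y := by
  ext i j
  simp only [skew, of_apply, Matrix.add_apply, Pi.add_apply]
  split_ifs <;> ring

theorem skew_smul (c : ℝ) (x : SkewCoord m) : skew (c • x) = c • skew x := by
  ext i j
  simp only [skew, of_apply, Matrix.smul_apply, Pi.smul_apply, smul_eq_mul]
  split_ifs <;> ring

theorem skew_zero : skew (0 : SkewCoord m) = 0 := by
  ext i j
  simp [skew]

/-- An entry of a skew-symmetric matrix as a function of the entries above the diagonal. -/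
noncomputable def skewEntry (i j : Fin m) : SkewCoord m →L[ℝ] ℝ :=
  LinearMap.toContinuousLinearMap
    { toFun := fun x => skew x i j
      map_add' := fun x y => by rw [skew_add, Matrix.add_apply]
      map_smul' := fun c x => by rw [skew_smul, Matrix.smul_apply, RingHom.id_apply] }

theorem skewEntry_apply (i j : Fin m) (x : SkewCoord m) : skewEntry i j x = skew x i j := rfl

theorem hasFDerivAt_skew (i j : Fin m) (x : SkewCoord m) :
    HasFDerivAt (fun x => skew x i j) (skewEntry i j) x :=
  (skewEntry i j).hasFDerivAt

theorem smoothOn_cayley_skew (s : Set (SkewCoord m)) : SmoothOn (fun x => cayley (skew x)) s :=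
  ((SmoothOn.const 1 s).add (smoothOn_skew s)).mul
    (((SmoothOn.const 1 s).sub (smoothOn_skew s)).inv
      fun x _ => (isUnit_one_sub (skew_transpose x)).ne_zero)

/-- This fixed-point identity yields the derivative `X + X = 2X` at `0` by the product rule, without
differentiating an inverse. -/
theorem cayley_eq_add {X : Matrix (Fin m) (Fin m) ℝ} (h : Xᵀ = -X) :
    cayley X = 1 + X + cayley X * X := by
  have h1 : cayley X * (1 - X) = 1 + X := by
    rw [cayley, mul_assoc, nonsing_inv_mul _ (isUnit_one_sub h), mul_one]
  rw [← h1, mul_sub, mul_one, sub_add_cancel]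

theorem cayley_zero : cayley (0 : Matrix (Fin m) (Fin m) ℝ) = 1 := by
  simp [cayley]

theorem hasFDerivAt_cayley_skew (i j : Fin m) :
    HasFDerivAt (fun x : SkewCoord m => cayley (skew x) i j) ((2 : ℝ) • skewEntry i j) 0 := by
  have hd : ∀ k, DifferentiableAt ℝ (fun x : SkewCoord m => cayley (skew x) i k) 0 := fun k =>
    ((contDiffOn_univ.1 (smoothOn_cayley_skew Set.univ i k)).differentiable
      (by simp)).differentiableAt
  have h := ((hasFDerivAt_const ((1 : Matrix (Fin m) (Fin m) ℝ) i j) (0 : SkewCoord m)).add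
    (hasFDerivAt_skew i j 0)).add
      (HasFDerivAt.fun_sum (u := Finset.univ) fun k _ =>
        (hd k).hasFDerivAt.mul (hasFDerivAt_skew k j 0))
  refine (h.congr_of_eventuallyEq (Filter.Eventually.of_forall fun x => ?_)).congr_fderiv ?_
  · conv_lhs => rw [cayley_eq_add (skew_transpose x), Matrix.add_apply, Matrix.add_apply,
      Matrix.mul_apply]
    rfl
  · simp only [skew_zero, cayley_zero, Matrix.zero_apply, zero_smul, add_zero, zero_add,
      Matrix.one_apply, ite_smul, one_smul, Finset.sum_ite_eq, Finset.mem_univ, if_true, two_smul]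

/-- The inclusion of the special orthogonal group into the space of matrices is smooth. -/
theorem contMDiff_coe : ContMDiff 𝓘(ℝ, SkewCoord m) 𝓘(ℝ, Fin m → Fin m → ℝ) ∞
    (fun (P : SO m) (i j : Fin m) => P.1 i j) := by
  rw [contMDiff_iff]
  refine ⟨continuous_pi fun i => continuous_pi fun j => continuous_subtype_val.matrix_elem i j,
    fun A y => ?_⟩
  refine contDiffOn_pi.2 fun i => contDiffOn_pi.2 fun j => ?_
  exact ((SmoothOn.const A.1 _).mul (smoothOn_cayley_skew _)) i j

theorem extChartAt_self (A : SO m) : extChartAt 𝓘(ℝ, SkewCoord m) A A = 0 := by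
  change upper (cayleyInv ((A.1)ᵀ * A.1)) = 0
  rw [transpose_mul, cayleyInv, sub_self, zero_mul]
  rfl

/-- A tangent vector as an element of the model space. -/
def coords {A : SO m} (v : TangentSpace 𝓘(ℝ, SkewCoord m) A) : SkewCoord m := v

/-- In the chart centred at `A` the inclusion is `x ↦ A * cayley (skew x)`, with `A` at the origin.
The factor `2` is the derivative of the Cayley transform there. -/
theorem toMatrix_eq (A : SO m) (v : TangentSpace 𝓘(ℝ, SkewCoord m) A) :
    A.toMatrix v = A.1 * ((2 : ℝ) • skew (coords v)) := by
  have hmd := (contMDiff_coe (m := m)).mdifferentiableAt (x := A) (by simp)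
  have hG : HasFDerivAt (fun (x : SkewCoord m) (i j : Fin m) => (A.1 * cayley (skew x)) i j)
      (ContinuousLinearMap.pi fun i => ContinuousLinearMap.pi fun j =>
        ∑ k, A.1 i k • (2 : ℝ) • skewEntry k j) 0 := by
    refine hasFDerivAt_pi.2 fun i => hasFDerivAt_pi.2 fun j => ?_
    simp only [Matrix.mul_apply]
    exact HasFDerivAt.fun_sum fun k _ => (hasFDerivAt_cayley_skew k j).const_mul (A.1 i k)
  have hw : fderivWithin ℝ (writtenInExtChartAt 𝓘(ℝ, SkewCoord m) 𝓘(ℝ, Fin m → Fin m → ℝ) A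
      (fun (P : SO m) (i j : Fin m) => P.1 i j)) (Set.range 𝓘(ℝ, SkewCoord m))
      (extChartAt 𝓘(ℝ, SkewCoord m) A A) = (ContinuousLinearMap.pi fun i =>
        ContinuousLinearMap.pi fun j => ∑ k, A.1 i k • (2 : ℝ) • skewEntry k j) := by
    rw [extChartAt_self, ModelWithCorners.range_eq_univ, fderivWithin_univ]
    exact hG.fderiv
  refine (congrArg (fun L => Matrix.of (L v)) (hmd.mfderiv.trans hw)).trans ?_
  ext i j
  change (ContinuousLinearMap.pi fun i => ContinuousLinearMap.pi fun j =>
    ∑ k, A.1 i k • (2 : ℝ) • skewEntry k j) (coords v) i j = _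
  simp [Matrix.mul_apply, skewEntry_apply]

/-- The tangent vector `A X` at `A`. -/
noncomputable def tangent (A : SO m) (X : Matrix (Fin m) (Fin m) ℝ) :
    TangentSpace 𝓘(ℝ, SkewCoord m) A :=
  -- The half compensates for the derivative `2X` of the Cayley chart.
  show SkewCoord m from (1 / 2 : ℝ) • upper X

theorem toMatrix_tangent (A : SO m) {X : Matrix (Fin m) (Fin m) ℝ} (hX : Xᵀ = -X) :
    A.toMatrix (tangent A X) = A.1 * X := by
  rw [toMatrix_eq]
  change A.1 * ((2 : ℝ) • skew ((1 / 2 : ℝ) • upper X)) = _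
  rw [skew_smul, skew_upper hX, smul_smul]
  norm_num

theorem eq_tangent_of_toMatrix {A : SO m} {v : TangentSpace 𝓘(ℝ, SkewCoord m) A}
    {X : Matrix (Fin m) (Fin m) ℝ} (h : A.toMatrix v = A.1 * X) : v = tangent A X := by
  rw [toMatrix_eq] at h
  have h1 := congrArg (fun M => (A.1)ᵀ * M) h
  simp only [← mul_assoc, transpose_mul, one_mul] at h1
  change coords v = (1 / 2 : ℝ) • upper X
  have h2 : upper ((2 : ℝ) • skew (coords v)) =
      (2 : ℝ) • coords v := by
    rw [← skew_smul, upper_skew]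
  rw [← h1, h2, smul_smul, show (1 / 2 : ℝ) * 2 = 1 by norm_num, one_smul]

theorem exists_eq_tangent {A : SO m} (v : TangentSpace 𝓘(ℝ, SkewCoord m) A) :
    ∃ X : Matrix (Fin m) (Fin m) ℝ, Xᵀ = -X ∧ v = tangent A X := by
  refine ⟨_, ?_, eq_tangent_of_toMatrix (toMatrix_eq A v)⟩
  rw [transpose_smul, skew_transpose, smul_neg]

theorem cayley_conj (A : SO m) {X : Matrix (Fin m) (Fin m) ℝ} (hX : Xᵀ = -X) :
    cayley ((A.1)ᵀ * X * A.1) = (A.1)ᵀ * cayley X * A.1 := by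
  have h1 : (1 - (A.1)ᵀ * X * A.1) * ((A.1)ᵀ * (1 - X)⁻¹ * A.1) = 1 := by
    have : 1 - (A.1)ᵀ * X * A.1 = (A.1)ᵀ * (1 - X) * A.1 := by
      rw [mul_sub, sub_mul, mul_one, transpose_mul]
    rw [this]
    calc _ = (A.1)ᵀ * (1 - X) * (A.1 * (A.1)ᵀ) * (1 - X)⁻¹ * A.1 := by simp only [mul_assoc]
      _ = 1 := by
        rw [mul_transpose, mul_one, mul_assoc (A.1)ᵀ, mul_nonsing_inv _ (isUnit_one_sub hX),
          mul_one, transpose_mul]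
  rw [cayley, inv_eq_right_inv h1]
  have : 1 + (A.1)ᵀ * X * A.1 = (A.1)ᵀ * (1 + X) * A.1 := by
    rw [mul_add, add_mul, mul_one, transpose_mul]
  rw [this]
  calc _ = (A.1)ᵀ * (1 + X) * (A.1 * (A.1)ᵀ) * (1 - X)⁻¹ * A.1 := by simp only [mul_assoc]
    _ = _ := by rw [mul_transpose, mul_one, cayley, mul_assoc (A.1)ᵀ]

theorem conj_transpose_eq_neg (A X : Matrix (Fin m) (Fin m) ℝ) (hX : Xᵀ = -X) :
    (Aᵀ * X * A)ᵀ = -(Aᵀ * X * A) := by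
  rw [Matrix.transpose_mul, Matrix.transpose_mul, transpose_transpose, hX]
  noncomm_ring

/-- In the charts centred at `P` and `AP`, left translation is the identity. -/
theorem mdifferentiableAt_mul_left (A P : SO m) :
    MDifferentiableAt 𝓘(ℝ, SkewCoord m) 𝓘(ℝ, SkewCoord m) (fun R : SO m => A * R) P := by
  rw [mdifferentiableAt_iff]
  refine ⟨(continuous_const.mul continuous_id).continuousAt, ?_⟩
  have : (writtenInExtChartAt 𝓘(ℝ, SkewCoord m) 𝓘(ℝ, SkewCoord m) P fun R : SO m => A * R) =
      id := by
    funext x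
    change upper (cayleyInv (((A.1 * P.1))ᵀ * (A.1 * (P.1 * cayley (skew x))))) = x
    rw [Matrix.transpose_mul, mul_assoc, ← mul_assoc _ A.1, transpose_mul, one_mul, ← mul_assoc,
      transpose_mul, one_mul, cayleyInv_cayley (skew_transpose x), upper_skew]
  rw [this]
  exact differentiableWithinAt_id

/-- In the charts centred at `P` and `PA`, right translation is the linear map `X ↦ Aᵀ X A`, because
the Cayley transform is conjugation-equivariant. -/
theorem mdifferentiableAt_mul_right (A P : SO m) :
    MDifferentiableAt 𝓘(ℝ, SkewCoord m) 𝓘(ℝ, SkewCoord m) (fun R : SO m => R * A) P := by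
  rw [mdifferentiableAt_iff]
  refine ⟨(continuous_id.mul continuous_const).continuousAt, ?_⟩
  have : (writtenInExtChartAt 𝓘(ℝ, SkewCoord m) 𝓘(ℝ, SkewCoord m) P fun R : SO m => R * A) =
      fun x => upper ((A.1)ᵀ * skew x * A.1) := by
    funext x
    change upper (cayleyInv (((P.1 * A.1))ᵀ * (P.1 * cayley (skew x) * A.1))) = _
    have h : (P.1 * A.1)ᵀ * (P.1 * cayley (skew x) * A.1) =
        (A.1)ᵀ * ((P.1)ᵀ * P.1) * cayley (skew x) * A.1 := by
      simp only [Matrix.transpose_mul, mul_assoc]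
    rw [h, transpose_mul, mul_one, ← cayley_conj A (skew_transpose x),
      cayleyInv_cayley (conj_transpose_eq_neg _ _ (skew_transpose x))]
  rw [this]
  refine (contDiffOn_pi.2 fun p => ?_ : ContDiffOn ℝ ∞ _ _).differentiableOn (by simp) _
    (Set.mem_range_self _)
  exact ((SmoothOn.const (A.1)ᵀ _).mul (smoothOn_skew _)).mul (SmoothOn.const A.1 _) p.1.1 p.1.2

/-- The differential of a map between matrix groups that extends to a linear map of matrices. -/
theorem toMatrix_mfderiv {f : SO m → SO m} {P : SO m}
    (hf : MDifferentiableAt 𝓘(ℝ, SkewCoord m) 𝓘(ℝ, SkewCoord m) f P)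
    (T : Matrix (Fin m) (Fin m) ℝ →ₗ[ℝ] Matrix (Fin m) (Fin m) ℝ) (hT : ∀ R, (f R).1 = T R.1)
    (v : TangentSpace 𝓘(ℝ, SkewCoord m) P) :
    (f P).toMatrix (mfderiv 𝓘(ℝ, SkewCoord m) 𝓘(ℝ, SkewCoord m) f P v) = T (P.toMatrix v) := by
  have hc := fun Q : SO m => (contMDiff_coe (m := m)).mdifferentiableAt (x := Q) (by simp)
  have h1 := mfderiv_comp P (hc (f P)) hf
  let S : (Fin m → Fin m → ℝ) →L[ℝ] (Fin m → Fin m → ℝ) := LinearMap.toContinuousLinearMap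
    (show (Fin m → Fin m → ℝ) →ₗ[ℝ] (Fin m → Fin m → ℝ) from
      (Matrix.ofLinearEquiv ℝ).symm.toLinearMap ∘ₗ T ∘ₗ (Matrix.ofLinearEquiv ℝ).toLinearMap)
  have h2 : (fun (Q : SO m) (i j : Fin m) => Q.1 i j) ∘ f =
      S ∘ (fun (Q : SO m) (i j : Fin m) => Q.1 i j) := by
    funext Q i j
    change (f Q).1 i j = T Q.1 i j
    rw [hT]
  have h3 := mfderiv_comp P S.mdifferentiableAt (hc P)
  rw [h2, h3, S.mfderiv_eq] at h1
  exact (congrArg (fun L => Matrix.of (L v)) h1).symm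

theorem mfderiv_mul_left_tangent (A P : SO m) {X : Matrix (Fin m) (Fin m) ℝ} (hX : Xᵀ = -X) :
    mfderiv 𝓘(ℝ, SkewCoord m) 𝓘(ℝ, SkewCoord m) (fun R : SO m => A * R) P (tangent P X) =
      tangent (A * P) X := by
  refine eq_tangent_of_toMatrix ?_
  rw [toMatrix_mfderiv (mdifferentiableAt_mul_left A P) (LinearMap.mulLeft ℝ A.1) (fun R => rfl),
    toMatrix_tangent P hX, LinearMap.mulLeft_apply, Submonoid.coe_mul, mul_assoc]

theorem mfderiv_mul_right_tangent (A P : SO m) {X : Matrix (Fin m) (Fin m) ℝ} (hX : Xᵀ = -X) :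
    mfderiv 𝓘(ℝ, SkewCoord m) 𝓘(ℝ, SkewCoord m) (fun R : SO m => R * A) P (tangent P X) =
      tangent (P * A) ((A.1)ᵀ * X * A.1) := by
  refine eq_tangent_of_toMatrix ?_
  rw [toMatrix_mfderiv (mdifferentiableAt_mul_right A P) (LinearMap.mulRight ℝ A.1) (fun R => rfl),
    toMatrix_tangent P hX, LinearMap.mulRight_apply, Submonoid.coe_mul, mul_assoc P.1 A.1,
    ← mul_assoc A.1, ← mul_assoc A.1, mul_transpose, one_mul, mul_assoc]

theorem tangent_add (A : SO m) (X Y : Matrix (Fin m) (Fin m) ℝ) :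
    tangent A (X + Y) = tangent A X + tangent A Y :=
  smul_add (1 / 2 : ℝ) (upper X) (upper Y)

theorem tangent_smul (A : SO m) (c : ℝ) (X : Matrix (Fin m) (Fin m) ℝ) :
    tangent A (c • X) = c • tangent A X :=
  smul_comm (1 / 2 : ℝ) c (upper X)

/-- The bilinear form on matrices given by a Riemannian metric at the identity. -/
noncomputable def metricForm (g : SO.RiemannianMetric m) :
    Matrix (Fin m) (Fin m) ℝ →ₗ[ℝ] Matrix (Fin m) (Fin m) ℝ →ₗ[ℝ] ℝ :=
  -- `tangent` reads only the entries above the diagonal, so the form is defined on all matrices;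
  -- its geometric meaning is confined to skew-symmetric ones.
  LinearMap.mk₂ ℝ (fun X Y => g.inner 1 (tangent 1 X) (tangent 1 Y))
    (fun X X' Y => by rw [tangent_add, map_add]; rfl)
    (fun c X Y => by rw [tangent_smul, map_smul]; rfl)
    (fun X Y Y' => by rw [tangent_add, map_add])
    (fun c X Y => by rw [tangent_smul, map_smul])

theorem IsBiInvariant.inner_tangent {g : SO.RiemannianMetric m} (hg : IsBiInvariant g) (A : SO m)
    {X Y : Matrix (Fin m) (Fin m) ℝ} (hX : Xᵀ = -X) (hY : Yᵀ = -Y) :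
    g.inner A (tangent A X) (tangent A Y) = metricForm g X Y := by
  have h := hg.1 A 1 (tangent 1 X) (tangent 1 Y)
  rw [mfderiv_mul_left_tangent A 1 hX, mfderiv_mul_left_tangent A 1 hY, mul_one] at h
  exact h

theorem IsBiInvariant.isAdInvariant {g : SO.RiemannianMetric m} (hg : IsBiInvariant g) :
    IsAdInvariant (metricForm g) := by
  refine ⟨fun X Y => g.symm 1 _ _, fun X hX h0 => g.pos 1 _ fun h => h0 ?_, fun U X Y hX hY => ?_⟩
  · have h1 := toMatrix_tangent 1 hX
    rw [h, toMatrix_eq] at h1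
    have h2 : skew (coords (0 : TangentSpace 𝓘(ℝ, SkewCoord m) (1 : SO m))) = 0 :=
      skew_zero
    rw [h2, smul_zero, mul_zero] at h1
    simpa using h1.symm
  -- Right translation by `U⁻¹` turns `X` at the identity into `U X Uᵀ` at `U⁻¹`, and left
  -- invariance brings this back to the identity.
  · have h := hg.2 U⁻¹ 1 (tangent 1 X) (tangent 1 Y)
    rw [mfderiv_mul_right_tangent _ 1 hX, mfderiv_mul_right_tangent _ 1 hY,
      hg.inner_tangent _ (conj_transpose_eq_neg _ _ hX) (conj_transpose_eq_neg _ _ hY), inv_coe,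
      transpose_transpose] at h
    exact h

end SO

/-! ### The differential of the projection to the sphere -/

section SphereProjection

variable {n : ℕ} [n.AtLeastTwo]

/-- The quadratic map of matrices that restricts to the projection `SO(2n) → S^{2n-2}`. -/
noncomputable def ambientProj (n : ℕ) [n.AtLeastTwo] (M : Fin (2 * n) → Fin (2 * n) → ℝ) :
    EuclideanSpace ℝ (Fin (2 * n - 1)) :=
  WithLp.toLp 2 fun i => -((Matrix.of M * complexStructure n * (Matrix.of M)ᵀ)
    (Fin.castLE (two_mul_sub_one_le n) i) (topIndex n))

theorem contDiff_ambientProj : ContDiff ℝ ∞ (ambientProj n) := by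
  refine (contDiff_euclidean.2 fun i => ?_)
  simp only [ambientProj, Matrix.mul_apply, of_apply, transpose_apply]
  fun_prop

/-- The map is homogeneous quadratic, so the derivative is the coefficient of `s` in its expansion
along `M + sN`. -/
theorem fderiv_ambientProj (M N : Fin (2 * n) → Fin (2 * n) → ℝ) :
    fderiv ℝ (ambientProj n) M N = WithLp.toLp 2 fun i =>
      -((Matrix.of N * complexStructure n * (Matrix.of M)ᵀ +
        Matrix.of M * complexStructure n * (Matrix.of N)ᵀ)
          (Fin.castLE (two_mul_sub_one_le n) i) (topIndex n)) := by
  set C : EuclideanSpace ℝ (Fin (2 * n - 1)) := WithLp.toLp 2 fun i =>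
      -((Matrix.of N * complexStructure n * (Matrix.of M)ᵀ +
        Matrix.of M * complexStructure n * (Matrix.of N)ᵀ)
          (Fin.castLE (two_mul_sub_one_le n) i) (topIndex n)) with hC
  have h1 : HasDerivAt (fun s : ℝ => ambientProj n (M + s • N)) (fderiv ℝ (ambientProj n) M N) 0 :=
    ((contDiff_ambientProj.differentiable (by simp)).differentiableAt).hasFDerivAt.hasLineDerivAt N
  have h2 : (fun s : ℝ => ambientProj n (M + s • N)) =
      fun s => ambientProj n M + s • C + (s * s) • ambientProj n N := by
    funext s
    ext i
    have h3 : Matrix.of (M + s • N) = Matrix.of M + s • Matrix.of N := rfl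
    simp only [ambientProj, hC, h3, transpose_add, transpose_smul, add_mul, mul_add,
      smul_mul_assoc, mul_smul_comm, Matrix.add_apply, Matrix.smul_apply, PiLp.add_apply,
      PiLp.smul_apply, smul_eq_mul]
    ring
  have h4 : HasDerivAt (fun s : ℝ => ambientProj n M + s • C + (s * s) • ambientProj n N) C 0 := by
    have h5 := (((hasDerivAt_id (0 : ℝ)).smul_const C).const_add (ambientProj n M)).add
      (((hasDerivAt_id (0 : ℝ)).mul (hasDerivAt_id (0 : ℝ))).smul_const (ambientProj n N))
    have h6 : (1 : ℝ) • C + ((1 : ℝ) * id (0 : ℝ) + id (0 : ℝ) * 1) • ambientProj n N = C := by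
      simp
    exact h5.congr_deriv h6
  rw [h2] at h1
  exact h1.unique h4

theorem coe_sphereProj (A : SO (2 * n)) :
    (sphereProj n A).1 = ambientProj n fun i j => A.1 i j := by
  ext i
  rw [sphereProj_apply]
  rfl

theorem contMDiff_ambientProj : ContMDiff 𝓘(ℝ, SkewCoord (2 * n))
    𝓘(ℝ, EuclideanSpace ℝ (Fin (2 * n - 1))) ∞
    (ambientProj n ∘ fun (A : SO (2 * n)) i j => A.1 i j) :=
  contDiff_ambientProj.contMDiff.comp SO.contMDiff_coe

theorem contMDiff_sphereProj :
    ContMDiff 𝓘(ℝ, SkewCoord (2 * n)) (𝓡 (2 * n - 2)) ∞ (sphereProj n) := by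
  have hmem : ∀ A : SO (2 * n), (ambientProj n ∘ fun (A : SO (2 * n)) i j => A.1 i j) A ∈
      Metric.sphere (0 : EuclideanSpace ℝ (Fin (2 * n - 1))) 1 := by
    intro A
    rw [Function.comp_apply, ← coe_sphereProj]
    exact (sphereProj n A).2
  have h := ContMDiff.codRestrict_sphere (n := 2 * n - 2) contMDiff_ambientProj hmem
  have heq : sphereProj n = Set.codRestrict _ _ hmem := by
    funext A
    exact Subtype.ext (coe_sphereProj A)
  rw [heq]
  exact h

/-- The differential of the projection to the sphere at `A Z`, as a vector of `ℝ^{2n}`. -/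
def projDeriv (A : SO (2 * n)) (Z : Matrix (Fin (2 * n)) (Fin (2 * n)) ℝ) : Fin (2 * n) → ℝ :=
  -(A.1 *ᵥ ((Z * complexStructure n - complexStructure n * Z) *ᵥ
    ((A.1)ᵀ *ᵥ Pi.single (topIndex n) 1)))

theorem toVec_mfderiv_sphereProj (A : SO (2 * n)) {Z : Matrix (Fin (2 * n)) (Fin (2 * n)) ℝ}
    (hZ : Zᵀ = -Z) (i : Fin (2 * n - 1)) :
    EvenSphere.toVec (sphereProj n A) (mfderiv 𝓘(ℝ, SkewCoord (2 * n)) (𝓡 (2 * n - 2))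
      (sphereProj n) A (SO.tangent A Z)) i =
      projDeriv A Z (Fin.castLE (two_mul_sub_one_le n) i) := by
  have h1 := mfderiv_comp A
    ((contMDiff_coe_sphere (m := ∞) (n := 2 * n - 2) (E := EuclideanSpace ℝ (Fin (2 * n - 1)))
      (sphereProj n A)).mdifferentiableAt (by simp))
    ((contMDiff_sphereProj A).mdifferentiableAt (by simp))
  have h2 : (Subtype.val : EvenSphere n → EuclideanSpace ℝ (Fin (2 * n - 1))) ∘ sphereProj n =
      ambientProj n ∘ fun (A : SO (2 * n)) i j => A.1 i j := by
    funext A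
    exact coe_sphereProj A
  have h3 := mfderiv_comp A
    ((contDiff_ambientProj (n := n)).contMDiff.mdifferentiable (by simp) fun i j => A.1 i j)
    (SO.contMDiff_coe.mdifferentiable (by simp) A)
  rw [h2, h3, mfderiv_eq_fderiv] at h1
  have h4 := congrArg (fun L => L (SO.tangent A Z)) h1
  have h5 : EvenSphere.toVec (sphereProj n A) (mfderiv 𝓘(ℝ, SkewCoord (2 * n)) (𝓡 (2 * n - 2))
      (sphereProj n) A (SO.tangent A Z)) = fderiv ℝ (ambientProj n) (fun i j => A.1 i j)
        (Matrix.of.symm (A.toMatrix (SO.tangent A Z))) := h4.symm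
  rw [h5, fderiv_ambientProj, SO.toMatrix_tangent A hZ]
  change -((A.1 * Z * complexStructure n * (A.1)ᵀ + A.1 * complexStructure n * (A.1 * Z)ᵀ) _ _) = _
  rw [projDeriv, mulVec_mulVec, mulVec_mulVec, mulVec_single_one, Pi.neg_apply, col_apply,
    transpose_mul, hZ]
  congr 2
  noncomm_ring

/-- The matrix `A (ZJ - JZ) Aᵀ` is skew, so its diagonal entry vanishes. Dropping the last
coordinate therefore loses nothing in inner products. -/
theorem projDeriv_topIndex (A : SO (2 * n)) {Z : Matrix (Fin (2 * n)) (Fin (2 * n)) ℝ}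
    (hZ : Zᵀ = -Z) : projDeriv A Z (topIndex n) = 0 := by
  have hJ := isComplexStructure_complexStructure n
  rw [projDeriv, mulVec_mulVec, mulVec_mulVec, mulVec_single_one, Pi.neg_apply, col_apply]
  set W := A.1 * (Z * complexStructure n - complexStructure n * Z) * (A.1)ᵀ with hW
  have hWt : Wᵀ = -W := by
    rw [hW]
    simp only [transpose_mul, transpose_sub, transpose_transpose, hZ, hJ.transpose_eq]
    noncomm_ring
  have h := congrFun (congrFun hWt (topIndex n)) (topIndex n)
  rw [transpose_apply, Matrix.neg_apply] at h
  linarith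

theorem dotProduct_eq_sum_castLE {x y : Fin (2 * n) → ℝ} (hx : x (topIndex n) = 0) :
    x ⬝ᵥ y = ∑ i : Fin (2 * n - 1), x (Fin.castLE (two_mul_sub_one_le n) i) *
      y (Fin.castLE (two_mul_sub_one_le n) i) := by
  rw [dotProduct, ← Equiv.sum_comp (blockEquiv (two_mul_sub_one_le n)), Fintype.sum_sum_type]
  have h1 : ∀ z, blockEquiv (two_mul_sub_one_le n) (Sum.inl z) =
      Fin.castLE (two_mul_sub_one_le n) z := fun z => Fin.ext (blockEquiv_inl_val _ z)
  have h2 : ∀ z, blockEquiv (two_mul_sub_one_le n) (Sum.inr z) = topIndex n := by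
    intro z
    apply Fin.ext
    rw [blockEquiv_inr_val]
    change 2 * n - 1 + z.val = 2 * n - 1
    omega
  simp [h1, h2, hx]

theorem roundMetric_mfderiv_sphereProj (c : ℝ) (A : SO (2 * n))
    {Z Z' : Matrix (Fin (2 * n)) (Fin (2 * n)) ℝ} (hZ : Zᵀ = -Z) (hZ' : Z'ᵀ = -Z') :
    roundMetric n c (sphereProj n A)
      (mfderiv 𝓘(ℝ, SkewCoord (2 * n)) (𝓡 (2 * n - 2)) (sphereProj n) A (SO.tangent A Z))
      (mfderiv 𝓘(ℝ, SkewCoord (2 * n)) (𝓡 (2 * n - 2)) (sphereProj n) A (SO.tangent A Z')) =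
      c * (projDeriv A Z ⬝ᵥ projDeriv A Z') := by
  rw [roundMetric, PiLp.inner_apply, dotProduct_eq_sum_castLE (projDeriv_topIndex A hZ)]
  congr 1
  refine Finset.sum_congr rfl fun i _ => ?_
  rw [toVec_mfderiv_sphereProj A hZ, toVec_mfderiv_sphereProj A hZ']
  exact mul_comm _ _

theorem EvenSphere.toVec_injective (y : EvenSphere n) : Function.Injective (y.toVec) :=
  injective_mvfderiv_subtypeVal_sphere (n := 2 * n - 2) y

theorem mfderiv_sphereProj_eq {A : SO (2 * n)} {Z : Matrix (Fin (2 * n)) (Fin (2 * n)) ℝ}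
    (hZ : Zᵀ = -Z) {t : TangentSpace (𝓡 (2 * n - 2)) (sphereProj n A)}
    (h : ∀ i, EvenSphere.toVec _ t i = projDeriv A Z (Fin.castLE (two_mul_sub_one_le n) i)) :
    mfderiv 𝓘(ℝ, SkewCoord (2 * n)) (𝓡 (2 * n - 2)) (sphereProj n) A (SO.tangent A Z) = t := by
  apply EvenSphere.toVec_injective
  ext i
  rw [toVec_mfderiv_sphereProj A hZ, h]

theorem mfderiv_sphereProj_eq_zero {A : SO (2 * n)} {Z : Matrix (Fin (2 * n)) (Fin (2 * n)) ℝ}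
    (hZ : Zᵀ = -Z) (h : projDeriv A Z = 0) :
    mfderiv 𝓘(ℝ, SkewCoord (2 * n)) (𝓡 (2 * n - 2)) (sphereProj n) A (SO.tangent A Z) = 0 := by
  refine mfderiv_sphereProj_eq hZ fun i => ?_
  rw [h, EvenSphere.toVec, map_zero]
  rfl

theorem EvenSphere.inner_toVec (y : EvenSphere n) (t : TangentSpace (𝓡 (2 * n - 2)) y) :
    inner ℝ y.1 (y.toVec t) = 0 := by
  have h := range_mvfderiv_subtypeVal (n := 2 * n - 2) y
  have h1 : y.toVec t ∈ (Submodule.span ℝ {y.1})ᗮ := by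
    rw [← h]
    exact ⟨t, rfl⟩
  exact (Submodule.mem_orthogonal_singleton_iff_inner_right).1 h1

/-- The unit vector whose image under a horizontal matrix determines the differential of the
projection. -/
def baseVec (A : SO (2 * n)) : Fin (2 * n) → ℝ :=
  complexStructure n *ᵥ ((A.1)ᵀ *ᵥ Pi.single (topIndex n) 1)

theorem baseVec_dotProduct_self (A : SO (2 * n)) : baseVec A ⬝ᵥ baseVec A = 1 := by
  rw [baseVec, (isComplexStructure_complexStructure n).mulVec_dotProduct_mulVec, ← SO.inv_coe,
    SO.mulVec_dotProduct_mulVec, single_dotProduct_self]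

theorem projDeriv_of_commute (A : SO (2 * n)) {Z : Matrix (Fin (2 * n)) (Fin (2 * n)) ℝ}
    (h : Z * complexStructure n = complexStructure n * Z) : projDeriv A Z = 0 := by
  rw [projDeriv, h, sub_self, zero_mulVec, mulVec_zero, neg_zero]

theorem projDeriv_of_isAntiSkew (A : SO (2 * n)) {Z : Matrix (Fin (2 * n)) (Fin (2 * n)) ℝ}
    (h : IsAntiSkew (complexStructure n) Z) :
    projDeriv A Z = -((2 : ℝ) • (A.1 *ᵥ (Z *ᵥ baseVec A))) := by
  have h1 : Z * complexStructure n - complexStructure n * Z =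
      (2 : ℝ) • (Z * complexStructure n) := by
    have : complexStructure n * Z = -(Z * complexStructure n) := by rw [h.anticomm, neg_neg]
    rw [this, two_smul, sub_neg_eq_add]
  rw [projDeriv, h1, smul_mulVec, mulVec_smul, baseVec, ← mulVec_mulVec]

theorem mulVec_baseVec_castLE (A : SO (2 * n)) (i : Fin (2 * n - 1)) :
    (A.1 *ᵥ baseVec A) (Fin.castLE (two_mul_sub_one_le n) i) = -(sphereProj n A).1 i := by
  rw [sphereProj_apply, neg_neg, baseVec, mulVec_mulVec, mulVec_mulVec, mulVec_single_one,
    col_apply]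

theorem mfderiv_sphereProj_surjective (A : SO (2 * n)) : Function.Surjective
    (mfderiv 𝓘(ℝ, SkewCoord (2 * n)) (𝓡 (2 * n - 2)) (sphereProj n) A) := by
  have hJ := isComplexStructure_complexStructure n
  intro t
  set u := EvenSphere.toVec _ t with hu
  set x : Fin (2 * n) → ℝ := fun j => if h : j.val < 2 * n - 1 then u ⟨j, h⟩ else 0 with hx
  have hx0 : x (topIndex n) = 0 := by simp [hx, topIndex]
  have hxi : ∀ i, x (Fin.castLE (two_mul_sub_one_le n) i) = u i := by
    intro i
    simp [hx]
  -- The factor `-1/2` inverts the differential `Z ↦ -2 A Z w` on anticommuting matrices, so the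
  -- antiwedge of `w` and `a` is a preimage of `t`.
  set a := (-(1 / 2) : ℝ) • ((A.1)ᵀ *ᵥ x) with ha
  -- `A w` is `-π(A)` in the first `2n-1` coordinates, and `t` is tangent to the sphere at `π(A)`.
  have ha1 : a ⬝ᵥ baseVec A = 0 := by
    rw [ha, smul_dotProduct, mulVec_dotProduct_transpose, transpose_transpose,
      dotProduct_eq_sum_castLE hx0]
    have h := EvenSphere.inner_toVec _ t
    rw [PiLp.inner_apply] at h
    simp only [hxi, mulVec_baseVec_castLE, mul_neg, Finset.sum_neg_distrib]
    rw [smul_eq_zero]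
    exact Or.inr (neg_eq_zero.2 h)
  -- Here `Jw = -Aᵀ e_{2n}`, and `x` has last coordinate `0`.
  have ha2 : a ⬝ᵥ (complexStructure n *ᵥ baseVec A) = 0 := by
    rw [ha, smul_dotProduct, baseVec, hJ.mulVec_mulVec_self, ← SO.inv_coe, dotProduct_neg,
      SO.mulVec_dotProduct_mulVec, dotProduct_single, hx0]
    simp
  refine ⟨SO.tangent A (antiWedge (complexStructure n) (baseVec A) a),
    mfderiv_sphereProj_eq (antiWedge_isAntiSkew hJ _ _).transpose_eq fun i => ?_⟩
  rw [projDeriv_of_isAntiSkew A (antiWedge_isAntiSkew hJ _ _),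
    antiWedge_mulVec hJ (baseVec_dotProduct_self A) ha1 ha2, ha, mulVec_smul, mulVec_mulVec,
    SO.mul_transpose, one_mulVec, smul_smul]
  norm_num
  exact (hxi i).symm

/-! ### Horizontal vectors and the comparison of metrics -/

theorem IsComplexStructure.antiPart_add {m : ℕ} {J W H : Matrix (Fin m) (Fin m) ℝ}
    (hJ : IsComplexStructure J) (hW : W * J = J * W) (hH : IsAntiSkew J H) :
    (1 / 2 : ℝ) • ((W + H) + J * (W + H) * J) = H := by
  have h1 : J * W * J = -W := by rw [← hW, mul_assoc, hJ.mul_self, mul_neg, mul_one]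
  have h2 : J * H * J = H := by
    rw [mul_assoc, hH.anticomm, mul_neg, ← mul_assoc, hJ.mul_self, neg_mul, one_mul, neg_neg]
  rw [mul_add, add_mul, h1, h2]
  module

/-- A skew-symmetric matrix orthogonal to all those commuting with `J` anticommutes with `J`. -/
theorem IsAdInvariant.isAntiSkew {m : ℕ} {J : Matrix (Fin m) (Fin m) ℝ}
    {β : Matrix (Fin m) (Fin m) ℝ →ₗ[ℝ] Matrix (Fin m) (Fin m) ℝ →ₗ[ℝ] ℝ}
    (hβ : IsAdInvariant β) (hJ : IsComplexStructure J) {Z : Matrix (Fin m) (Fin m) ℝ}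
    (hZ : Zᵀ = -Z) (h : ∀ W, Wᵀ = -W → W * J = J * W → β Z W = 0) : IsAntiSkew J Z := by
  set W := Z - J * Z * J with hW
  set H := Z + J * Z * J with hH
  have hWt : Wᵀ = -W := by
    rw [hW, transpose_sub, hJ.transpose_conj hZ, hZ]
    abel
  have hWJ : W * J = J * W := hJ.commute_part Z
  have hHa : IsAntiSkew J H := by
    refine ⟨?_, ?_⟩
    · rw [hH, transpose_add, hJ.transpose_conj hZ, hZ]
      abel
    · rw [hH, add_mul, mul_add, mul_assoc (J * Z), hJ.mul_self, ← mul_assoc, ← mul_assoc,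
        hJ.mul_self]
      noncomm_ring
  have h1 : β W H = 0 := hβ.orthogonal hJ hWt hWJ hHa
  have h2 : (2 : ℝ) • Z = W + H := by
    rw [hW, hH, two_smul]
    abel
  have h3 : β W W = 0 := by
    have h4 : β ((2 : ℝ) • Z) W = 0 := by rw [map_smul, LinearMap.smul_apply, h W hWt hWJ, smul_zero]
    rwa [h2, map_add, LinearMap.add_apply, hβ.symm H, h1, add_zero] at h4
  have h5 : Z = J * Z * J := sub_eq_zero.1 (hβ.eq_zero hWt h3)
  refine ⟨hZ, ?_⟩
  conv_lhs => rw [h5]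
  rw [mul_assoc, hJ.mul_self, mul_neg, mul_one]

variable {β : Matrix (Fin (2 * n)) (Fin (2 * n)) ℝ →ₗ[ℝ]
  Matrix (Fin (2 * n)) (Fin (2 * n)) ℝ →ₗ[ℝ] ℝ}

/-- The projection to the sphere factors through `SO(2n)/U(n)`, so the kernel of its differential
contains `u(n)`. -/
theorem IsAdInvariant.isAntiSkew_of_horizontal (hβ : IsAdInvariant β) {A : SO (2 * n)}
    {Z : Matrix (Fin (2 * n)) (Fin (2 * n)) ℝ} (hZ : Zᵀ = -Z)
    (h : ∀ K, Kᵀ = -K → projDeriv A K = 0 → β Z K = 0) : IsAntiSkew (complexStructure n) Z :=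
  hβ.isAntiSkew (isComplexStructure_complexStructure n) hZ fun W hW hWJ =>
    h W hW (projDeriv_of_commute A hWJ)

/-- A matrix orthogonal to the kernel of the differential of the projection is an antiwedge. -/
theorem IsAdInvariant.eq_antiWedge_of_horizontal (hβ : IsAdInvariant β) {A : SO (2 * n)}
    {Z : Matrix (Fin (2 * n)) (Fin (2 * n)) ℝ} (hZ : Zᵀ = -Z)
    (h : ∀ K, Kᵀ = -K → projDeriv A K = 0 → β Z K = 0) :
    Z = antiWedge (complexStructure n) (baseVec A) (Z *ᵥ baseVec A) := by
  have hJ := isComplexStructure_complexStructure n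
  have hw := baseVec_dotProduct_self A
  have hZa := hβ.isAntiSkew_of_horizontal hZ h
  have h1 := hZa.dotProduct_mulVec_self (baseVec A)
  have h2 := hZa.dotProduct_mulVec_conj hJ (baseVec A)
  set Z₁ := antiWedge (complexStructure n) (baseVec A) (Z *ᵥ baseVec A)
  -- The difference kills `w`, hence lies in the kernel of the differential. It is orthogonal to `Z`
  -- by hypothesis and to `Z₁` by `antiWedge_ker`, so it vanishes.
  have hK : IsAntiSkew (complexStructure n) (Z - Z₁) := hZa.sub (antiWedge_isAntiSkew hJ _ _)
  have hKw : (Z - Z₁) *ᵥ baseVec A = 0 := by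
    rw [sub_mulVec, antiWedge_mulVec hJ hw h1 h2, sub_self]
  have h3 : β Z (Z - Z₁) = 0 := by
    refine h _ hK.transpose_eq ?_
    rw [projDeriv_of_isAntiSkew A hK, hKw, mulVec_zero, smul_zero, neg_zero]
  have h4 : β Z₁ (Z - Z₁) = 0 := hβ.antiWedge_ker hJ hw h1 h2 hK hKw
  refine sub_eq_zero.1 (hβ.eq_zero hK.transpose_eq ?_)
  rw [map_sub, hβ.symm _ Z, hβ.symm _ Z₁, h3, h4, sub_zero]

/-- The first standard basis vector of `ℝ^{2n}`. -/
def bottomIndex (n : ℕ) [n.AtLeastTwo] : Fin (2 * n) :=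
  ⟨0, by have := Nat.AtLeastTwo.prop (n := n); omega⟩

theorem single_bottomIndex_dotProduct :
    (Pi.single (bottomIndex n) (1 : ℝ) : Fin (2 * n) → ℝ) ⬝ᵥ Pi.single (topIndex n) 1 = 0 := by
  have hn := Nat.AtLeastTwo.prop (n := n)
  have : topIndex n ≠ bottomIndex n := by
    simp only [topIndex, bottomIndex, ne_eq, Fin.mk.injEq]
    omega
  simp [this.symm]

/-- This is where `n ≥ 2` matters: for `n = 1` the vectors `e_1` and `J e_2` are parallel. -/
theorem single_bottomIndex_dotProduct_conj :
    (Pi.single (bottomIndex n) (1 : ℝ) : Fin (2 * n) → ℝ) ⬝ᵥ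
      (complexStructure n *ᵥ Pi.single (topIndex n) 1) = 0 := by
  have hn := Nat.AtLeastTwo.prop (n := n)
  have : bottomIndex n ≠ Fin.castLE (two_mul_sub_one_le n) (lastIndex n) := by
    intro h
    have := congrArg Fin.val h
    simp only [bottomIndex, lastIndex, Fin.val_castLE] at this
    omega
  rw [complexStructure_mulVec_topIndex]
  simp [this]

/-- The value of an invariant form on a standard antiwedge, which determines the form on the
matrices anticommuting with the complex structure. -/
noncomputable def formScale (β : Matrix (Fin (2 * n)) (Fin (2 * n)) ℝ →ₗ[ℝ]
    Matrix (Fin (2 * n)) (Fin (2 * n)) ℝ →ₗ[ℝ] ℝ) : ℝ :=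
  β (antiWedge (complexStructure n) (Pi.single (topIndex n) 1) (Pi.single (bottomIndex n) 1))
    (antiWedge (complexStructure n) (Pi.single (topIndex n) 1) (Pi.single (bottomIndex n) 1))

theorem IsAdInvariant.formScale_pos (hβ : IsAdInvariant β) : 0 < formScale β := by
  have hJ := isComplexStructure_complexStructure n
  refine hβ.pos _ (antiWedge_isAntiSkew hJ _ _).transpose_eq fun h0 => ?_
  have h := antiWedge_mulVec hJ (single_dotProduct_self (topIndex n))
    single_bottomIndex_dotProduct single_bottomIndex_dotProduct_conj
  rw [h0, zero_mulVec] at h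
  simpa using congrFun h (bottomIndex n)

variable {g : SO.RiemannianMetric (2 * n)}

theorem SO.IsBiInvariant.isIsometricToNormal (hg : SO.IsBiInvariant g) :
    IsIsometricToNormal n g (formScale (SO.metricForm g) / 2)
      (formScale (SO.metricForm g) / 2 / 2) := by
  have hJ := isComplexStructure_complexStructure n
  have hβ := hg.isAdInvariant
  intro B X hX X' hX' Y hY Y' hY' v v' h h' hv hv' hh hh'
  set A := SO.incl (two_mul_sub_one_le n) B
  -- The horizontal part of `AZ` is `A · ½(Z + JZJ)`, independently of the bi-invariant metric.
  have key : ∀ {X Y v h}, X ∈ p₁ n → Y ∈ p₂ n →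
      A.toMatrix v = A.1 * padZero (two_mul_sub_one_le n) (X + Y) → IsHorizontalPart g A v h →
      ∃ H, IsAntiSkew (complexStructure n) H ∧ h = SO.tangent A H ∧
        (1 / 2 : ℝ) • (padZero (two_mul_sub_one_le n) (X + Y) + complexStructure n *
          padZero (two_mul_sub_one_le n) (X + Y) * complexStructure n) = H := by
    intro X Y v h hX hY hv hh
    obtain ⟨⟨W, ⟨hW, hWJ⟩, hvW⟩, hh⟩ := hh
    obtain ⟨H, hH, rfl⟩ := SO.exists_eq_tangent h
    have hHa : IsAntiSkew (complexStructure n) H := by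
      refine hβ.isAntiSkew hJ hH fun V hV hVJ => ?_
      rw [← hg.inner_tangent A hH hV]
      exact hh _ ⟨V, ⟨hV, hVJ⟩, SO.toMatrix_tangent A hV⟩
    refine ⟨H, hHa, rfl, ?_⟩
    have h1 : v = SO.tangent A W + SO.tangent A H := by
      rw [← SO.eq_tangent_of_toMatrix hvW, sub_add_cancel]
    have hWt : Wᵀ = -W := hW
    rw [← SO.tangent_add] at h1
    rw [h1, SO.toMatrix_tangent A (by rw [transpose_add, hWt, hH]; abel)] at hv
    have h2 := congrArg (fun M => (A.1)ᵀ * M) hv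
    simp only [← mul_assoc, SO.transpose_mul, one_mul] at h2
    rw [← h2]
    exact hJ.antiPart_add hWJ hHa
  obtain ⟨H, hH, rfl, hHX⟩ := key hX hY hv hh
  obtain ⟨H', hH', rfl, hHX'⟩ := key hX' hY' hv' hh'
  rw [hg.inner_tangent A hH.transpose_eq hH'.transpose_eq,
    hβ.eq_mul_Q hJ (single_dotProduct_self (topIndex n)) (single_dotProduct_self (bottomIndex n))
      single_bottomIndex_dotProduct single_bottomIndex_dotProduct_conj hH hH', ← hHX, ← hHX',
    Q_antiPart hX hX' hY hY' rfl rfl, ← formScale]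
  ring

theorem SO.IsBiInvariant.isRiemannianSubmersion (hg : SO.IsBiInvariant g) :
    IsRiemannianSubmersion 𝓘(ℝ, SkewCoord (2 * n)) (𝓡 (2 * n - 2))
      (fun A v w => g.inner A v w) (roundMetric n (formScale (SO.metricForm g) / 2 / 2))
      (sphereProj n) := by
  have hJ := isComplexStructure_complexStructure n
  have hβ := hg.isAdInvariant
  refine ⟨contMDiff_sphereProj, sphereProj_surjective, mfderiv_sphereProj_surjective,
    fun A v w hv hw => ?_, isConnected_sphereProj_preimage⟩
  obtain ⟨Z, hZ, rfl⟩ := SO.exists_eq_tangent v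
  obtain ⟨Z', hZ', rfl⟩ := SO.exists_eq_tangent w
  have hhor : ∀ {V : Matrix (Fin (2 * n)) (Fin (2 * n)) ℝ}, Vᵀ = -V →
      (∀ u, mfderiv 𝓘(ℝ, SkewCoord (2 * n)) (𝓡 (2 * n - 2)) (sphereProj n) A u = 0 →
        g.inner A (SO.tangent A V) u = 0) →
      ∀ K, Kᵀ = -K → projDeriv A K = 0 → SO.metricForm g V K = 0 := by
    intro V hV h K hK hK0
    rw [← hg.inner_tangent A hV hK]
    exact h _ (mfderiv_sphereProj_eq_zero hK hK0)
  have hz := hhor hZ hv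
  have hz' := hhor hZ' hw
  have ha := hβ.isAntiSkew_of_horizontal hZ hz
  have ha' := hβ.isAntiSkew_of_horizontal hZ' hz'
  -- The two factors `-2` in the differential give `4 λ₂ (Zw · Z'w)` on the sphere, equal to this
  -- value for `λ₂ = c/4`.
  have hform : SO.metricForm g Z Z' =
      formScale (SO.metricForm g) * ((Z *ᵥ baseVec A) ⬝ᵥ (Z' *ᵥ baseVec A)) := by
    conv_lhs => rw [hβ.eq_antiWedge_of_horizontal hZ' hz']
    exact hβ.apply_antiWedge hJ (single_dotProduct_self (topIndex n))
      (single_dotProduct_self (bottomIndex n)) single_bottomIndex_dotProduct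
      single_bottomIndex_dotProduct_conj (baseVec_dotProduct_self A)
      (ha'.dotProduct_mulVec_self _) (ha'.dotProduct_mulVec_conj hJ _) ha
  beta_reduce
  rw [roundMetric_mfderiv_sphereProj _ A hZ hZ', hg.inner_tangent A hZ hZ', hform,
    projDeriv_of_isAntiSkew A ha, projDeriv_of_isAntiSkew A ha', neg_dotProduct, dotProduct_neg,
    neg_neg, smul_dotProduct, dotProduct_smul, SO.mulVec_dotProduct_mulVec]
  simp only [smul_eq_mul]
  ring

end SphereProjection

theorem mainTheorem1 (n : ℕ) [n.AtLeastTwo]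
    (g : SO.RiemannianMetric (2 * n)) (hg : SO.IsBiInvariant g) :
    ∃ (Φ : SO (2 * n - 1) ⧸ smallUnitaryInSO n ≃ₜ SO (2 * n) ⧸ unitaryInSO n)
      (q : SO (2 * n - 1) ⧸ smallUnitaryInSO n → SO (2 * n - 1) ⧸ evenInSO n)
      (Ψ : SO (2 * n - 1) ⧸ evenInSO n ≃ₜ EvenSphere n),
      (∀ B : SO (2 * n - 1), Φ (QuotientGroup.mk B) =
        QuotientGroup.mk (SO.incl (two_mul_sub_one_le n) B)) ∧
      (∀ B : SO (2 * n - 1), q (QuotientGroup.mk B) = QuotientGroup.mk B) ∧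
      (∀ (B : SO (2 * n - 1)) (i : Fin (2 * n - 1)),
        (Ψ (QuotientGroup.mk B)).1 i = B.1 i (lastIndex n)) ∧
      ∃ lam₁ lam₂ : ℝ, 0 < lam₁ ∧ lam₂ = lam₁ / 2 ∧
        IsIsometricToNormal n g lam₁ lam₂ ∧
        IsRiemannianSubmersion 𝓘(ℝ, SkewCoord (2 * n)) (𝓡 (2 * n - 2))
          (fun A v w => g.inner A v w) (roundMetric n lam₂)
          (fun A : SO (2 * n) => Ψ (q (Φ.symm (QuotientGroup.mk A)))) := by
  refine ⟨cosetHomeo n, Subgroup.quotientMapOfLE (smallUnitaryInSO_le n), sphereHomeo n,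
    cosetHomeo_mk n, fun _ => rfl, fun B i => ?_, _, _, half_pos hg.isAdInvariant.formScale_pos,
    rfl, hg.isIsometricToNormal, hg.isRiemannianSubmersion⟩
  rw [sphereHomeo_mk]
  change (B.1 *ᵥ Pi.single (lastIndex n) 1) i = _
  rw [mulVec_single_one, col_apply]
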